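/- **Setting.** Let $(M,g,J)$ be a smooth almost-Hermitian 4-manifold: $g$ is a Riemannian metric with Levi-Civita connection $\nabla$, and $J$ is a $g$-compatible almost-complex structure. It is called Hermitian if $J$ is integrable. Orient $M$ so that the 2-form $g_{ac}J^c{}_b$ is anti-self-dual. Then locally $J^a{}_b=\mathrm i(o^A\iota_B+\iota^Ao_B)\delta^{A'}_{B'}$ for spinor fields with $o_A\iota^A=1$. With a primed spin frame $o^{A'},\iota^{A'}$, $o_{A'}\iota^{A'}=1$, let $\ell=o^Ao^{A'}$, $m=o^A\iota^{A'}$, $\tilde m=\iota^Ao^{A'}$, $n=\iota^A\iota^{A'}$ be the associated (complex) null tetrad; so $g(\ell,n)=1$, $g(m,\tilde m)=-1$, all other products vanish, $\ell,m$ span the $-\mathrm i$ eigenbundle of $J$, and $\tilde m,n$ the $+\mathrm i$ eigenbundle. Any smooth local tetrad of this kind is allowed. Put $$f_a=-\tfrac12J^b{}_c\nabla_bJ^c{}_a,\qquad \omega_a=\iota_B\nabla_ao^B,\qquad P_a=\omega_a-\tfrac{\mathrm i}{2}J^b{}_af_b .$$ A weighted field of weights $(w,p)$, $w\in\mathbb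 R$, $p\in\mathbb Z$, is one that is multiplied by $\Omega^wz^p$ under $g\to\Omega^2g$ (with $o^A\to\Omega^{-1/2}o^A$, $\iota^A\to\Omega^{-1/2}\iota^A$) and $(o^A,\iota^A)\to(zo^A,z^{-1}\iota^A)$. On scalars $\psi$, covectors $v_b$ and primed spinors $\varphi_{B'}$ of weights $(w,p)$ the connection $\mathscr C_a$ is $$\mathscr C_a\psi=\nabla_a\psi+(wf_a+pP_a)\psi,\qquad \mathscr C_av_b=\nabla_av_b+(wf_a+pP_a)v_b-(f_av_b+f_bv_a-g_{ab}f^cv_c),$$ $$\mathscr C_{AA'}\varphi_{B'}=\nabla_{AA'}\varphi_{B'}+(wf_{AA'}+pP_{AA'})\varphi_{B'}-f_{AB'}\varphi_{A'} .$$ Let $\Box^{\mathscr C}=g^{ab}\mathscr C_a\mathscr C_b$, $\Box=g^{ab}\nabla_a\nabla_b$, $\tilde{\mathscr C}_{A'}=o^A\mathscr C_{AA'}$, $\mathscr C_{A'}=\iota^A\mathscr C_{AA'}$; primed indices are raised by $\xi^{A'}=\epsilon^{A'B'}\xi_{B'}$. Let $D,D',\delta,\delta'$ be the derivatives along $\ell,n,m,\tilde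 m$, and $\kappa=m^aD\ell_a$, $\sigma=m^a\delta\ell_a$, $\rho=m^a\delta'\ell_a$, $\tau=m^aD'\ell_a$, $\varepsilon=\frac12(n^aD\ell_a+m^aD\tilde m_a)$, $\beta=\frac12(n^a\delta\ell_a+m^a\delta\tilde m_a)$ (here $D\ell_a=\ell^b\nabla_b\ell_a$, etc.). A prime on a coefficient exchanges $\ell\leftrightarrow n$ and $m\leftrightarrow\tilde m$; a tilde exchanges $m\leftrightarrow\tilde m$. Curvature conventions are $(\nabla_a\nabla_b-\nabla_b\nabla_a)V^d=R_{abc}{}^dV^c$, $R_{ab}=R_{acb}{}^c$, $R=g^{ab}R_{ab}$ (so $R<0$ on round spheres and $\Box+\frac R6$ is the conformal Laplacian); $C_{abcd}$ is the Weyl tensor and $\Psi_2=C_{abcd}\ell^am^b\tilde m^cn^d$. **Proposition.** 1. On smooth scalar fields of any weights $(w,p)$, $$\begin{aligned}\tfrac12\Box^{\mathscr C}={}&[D-(p-1)\varepsilon+\tilde\varepsilon+(w-\tfrac p2+1)\rho-\tilde\rho][D'+p\varepsilon'+(w+\tfrac p2)\rho']\\&-[\delta-(p-1)\beta+\tilde\beta'+(w-\tfrac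 p2+1)\tau-\tilde\tau'][\delta'+p\beta'+(w+\tfrac p2)\tau']\\&+\tfrac32p\Psi_2-p(\sigma\sigma'-\kappa\kappa').\end{aligned}$$ 2. Suppose $(M,g,J)$ is Hermitian, and let $$\begin{aligned}\mathrm T_s=2\big\{&[D-(2s-1)\varepsilon+\tilde\varepsilon-2s\rho-\tilde\rho][D'+2s\varepsilon'-\rho']\\&-[\delta-(2s-1)\beta+\tilde\beta'-2s\tau-\tilde\tau'][\delta'+2s\beta'-\tau']-2(s-\tfrac12)(s-1)\Psi_2\big\}\end{aligned}$$ be the Teukolsky operator of spin weight $s\in\frac12\mathbb Z$. For every smooth scalar field $\chi$ of weights $w=-s-1$, $p=2s$, $$\mathrm T_s\chi=\big[\Box^{\mathscr C}-2(2s^2+1)\Psi_2\big]\chi .$$ 3. Suppose $(M,g,J)$ is conformally Kähler: $\hat g=\phi^2g$ is Kähler with respect to $J$ for a smooth function $\phi>0$. For every smooth scalar field $\eta$ of weights $(w,0)$, $$\Box^{\mathscr C}\eta=\phi^{-(w+1)}\big(\Box+2\Psi_2+\tfrac R6\big)[\phi^{w+1}\eta].$$ 4. Suppose the geometry is conformally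 self-dual, $*C_{abcd}=C_{abcd}$. If $J$ is integrable, then on smooth scalar fields of any weights $(w,p)$ $$\mathscr C^{A'}\tilde{\mathscr C}_{A'}=\tfrac12\Box^{\mathscr C},\qquad[\mathscr C_{A'},\tilde{\mathscr C}^{A'}]=0 .$$ For $p=0$ both identities hold without integrability of $J$. -/

import Mathlib

open scoped Manifold ContDiff

noncomputable section

namespace AlmostHermitianNP

section Fields

/-- The model space of the 4-manifolds considered here. -/
abbrev E4 : Type := EuclideanSpace ℝ (Fin 4)

variable (M : Type*) [TopologicalSpace M] [ChartedSpace E4 M]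

/-- Real vector fields (no regularity built in). -/
abbrev RField : Type _ := Π x : M, TangentSpace (𝓡 4) x

/-- Complex vector fields, i.e. sections of `TM ⊗ ℂ`: the pair `(X, Y)` stands for `X + iY`. -/
abbrev CField : Type _ := Π x : M, TangentSpace (𝓡 4) x × TangentSpace (𝓡 4) x

/-- Fields of real bilinear forms. -/
abbrev BilinField : Type _ :=
  Π x : M, TangentSpace (𝓡 4) x →L[ℝ] TangentSpace (𝓡 4) x →L[ℝ] ℝ

/-- Fields of endomorphisms of the tangent spaces. -/
abbrev EndField : Type _ := Π x : M, TangentSpace (𝓡 4) x →L[ℝ] TangentSpace (𝓡 4) x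

variable {M}

/-- The real part of a complex vector field. -/
def CField.re (V : CField M) : RField M := fun x => (V x).1

/-- The imaginary part of a complex vector field. -/
def CField.im (V : CField M) : RField M := fun x => (V x).2

/-- The complex-bilinear extension of a field of bilinear forms. -/
def cinner (g : BilinField M) (V W : CField M) (x : M) : ℂ :=
  ⟨g x (V.re x) (W.re x) - g x (V.im x) (W.im x), g x (V.re x) (W.im x) + g x (V.im x) (W.re x)⟩

/-- The derivative `V(F)` of a complex function along a complex vector field. -/
def cdir (V : CField M) (F : M → ℂ) (x : M) : ℂ :=
  mvfderiv (𝓡 4) F x (V.re x) + Complex.I * mvfderiv (𝓡 4) F x (V.im x)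

/-- The complex-bilinear extension of the Lie bracket of vector fields. -/
def cbracket (V W : CField M) : CField M := fun x =>
  (VectorField.mlieBracket (𝓡 4) V.re W.re x - VectorField.mlieBracket (𝓡 4) V.im W.im x,
   VectorField.mlieBracket (𝓡 4) V.re W.im x + VectorField.mlieBracket (𝓡 4) V.im W.re x)

/-- The complex-linear extension of an endomorphism field. -/
def capply (J : EndField M) (V : CField M) : CField M := fun x => (J x (V.re x), J x (V.im x))

/-- The Koszul formula: `koszul g X Y Z = g(∇_X Y, Z)`, where `∇` is the (complex-linearly
extended) Levi-Civita connection of `g`. -/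
def koszul (g : BilinField M) (X Y Z : CField M) (x : M) : ℂ :=
  (1 / 2) * (cdir X (cinner g Y Z) x + cdir Y (cinner g X Z) x - cdir Z (cinner g X Y) x
    + cinner g (cbracket X Y) Z x - cinner g (cbracket X Z) Y x - cinner g (cbracket Y Z) X x)

variable [IsManifold (𝓡 4) ∞ M]

/-- A real vector field is smooth at `x`. -/
def SmoothFieldAt (X : RField M) (x : M) : Prop :=
  ContMDiffAt (𝓡 4) (𝓡 4).tangent ∞ (fun y => (⟨y, X y⟩ : TangentBundle (𝓡 4) M)) x

/-- `∇J = 0` for the Levi-Civita connection of the metric `g`, for which `J` is skew: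
`g(∇_X (J Y) - J (∇_X Y), Z) = 0` for all `X, Y, Z`. For a Riemannian metric `g` and a
`g`-orthogonal almost-complex structure `J` this says that `(g, J)` is Kähler. -/
def IsKahlerPair (g : BilinField M) (J : EndField M) : Prop :=
  ∀ (x : M) (X Y Z : CField M),
    SmoothFieldAt X.re x → SmoothFieldAt X.im x → SmoothFieldAt Y.re x → SmoothFieldAt Y.im x →
    SmoothFieldAt Z.re x → SmoothFieldAt Z.im x →
    koszul g X (capply J Y) Z x + koszul g X Y (capply J Z) x = 0

variable (M) in
/-- A smooth almost-Hermitian structure on a 4-manifold: a Riemannian metric and a compatible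
almost-complex structure. The manifold is oriented so that the 2-form `g(J·,·)` is
anti-self-dual (see `NullTetrad.vol`). -/
structure AlmostHermitian where
  /-- the Riemannian metric -/
  metric : Bundle.ContMDiffRiemannianMetric (𝓡 4) ∞ E4 (fun x : M => TangentSpace (𝓡 4) x)
  /-- the almost-complex structure -/
  J : EndField M
  J_smooth : ContMDiff (𝓡 4) ((𝓡 4).prod 𝓘(ℝ, E4 →L[ℝ] E4)) ∞
    (fun x => Bundle.TotalSpace.mk' (E4 →L[ℝ] E4)
      (E := fun x : M => TangentSpace (𝓡 4) x →L[ℝ] TangentSpace (𝓡 4) x) x (J x))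
  J_sq : ∀ (x : M) (v : TangentSpace (𝓡 4) x), J x (J x v) = -v
  J_orthogonal : ∀ (x : M) (v w : TangentSpace (𝓡 4) x),
    metric.inner x (J x v) (J x w) = metric.inner x v w

/-- The metric tensor. -/
def AlmostHermitian.g (H : AlmostHermitian M) : BilinField M := fun x => H.metric.inner x

/-- `J` is integrable (the almost-Hermitian manifold is Hermitian): the Nijenhuis tensor
vanishes. -/
def AlmostHermitian.IsHermitian (H : AlmostHermitian M) : Prop :=
  ∀ (x : M) (X Y : RField M), SmoothFieldAt X x → SmoothFieldAt Y x →
    VectorField.mlieBracket (𝓡 4) (fun y => H.J y (X y)) (fun y => H.J y (Y y)) x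
      - H.J x (VectorField.mlieBracket (𝓡 4) (fun y => H.J y (X y)) Y x)
      - H.J x (VectorField.mlieBracket (𝓡 4) X (fun y => H.J y (Y y)) x)
      - VectorField.mlieBracket (𝓡 4) X Y x = 0

end Fields

/-- The alternating symbols `ε_{AB}`, `ε^{AB}`, with `ε_{01} = ε^{01} = 1`. They lower and raise
spinor indices by `ξ_B = ξ^A ε_{AB}` and `ξ^A = ε^{AB} ξ_B`. -/
def eps (A B : Fin 2) : ℂ := if A = B then 0 else if A = 0 then 1 else -1

/-- Pairs of spinor indices `(A, A')`. -/
abbrev Idx : Type := Fin 2 × Fin 2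

/-- The components `ε_{AB} ε_{A'B'}` of the metric in a tetrad that comes from a spin frame. -/
def eta (a b : Idx) : ℂ := eps a.1 b.1 * eps a.2 b.2

/-- The matrix `eta` is its own inverse, so it gives the components of `g^{ab}` as well. -/
theorem eta_inv (a c : Idx) : ∑ b, eta a b * eta b c = if a = c then 1 else 0 := by
  rcases a with ⟨a, a'⟩
  rcases c with ⟨c, c'⟩
  fin_cases a <;> fin_cases a' <;> fin_cases c <;> fin_cases c' <;>
    simp [eta, eps, Fintype.sum_prod_type]

section Tetrad

variable {M : Type*} [TopologicalSpace M] [ChartedSpace E4 M] [IsManifold (𝓡 4) ∞ M]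

/-- A smooth null tetrad, on an open set, adapted to the almost-complex structure `J`. It comes
from the principal spinors `o^A, ι^A` of `J` and an arbitrary primed spin frame `o^{A'}, ι^{A'}`
with `o_A ι^A = o_{A'} ι^{A'} = 1` (determined by the tetrad up to a common sign), as
* `Z (0,0) = ℓ = o^A o^{A'}`, `Z (0,1) = m = o^A ι^{A'}` (eigenvectors of `J` for `-i`),
* `Z (1,0) = m̃ = ι^A o^{A'}`, `Z (1,1) = n = ι^A ι^{A'}` (eigenvectors of `J` for `+i`),
so that `g(ℓ, n) = 1`, `g(m, m̃) = -1` and the other products vanish. No reality condition is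
imposed: `(ℓ, m)` is any local frame of the `-i` eigenbundle, and it determines `(m̃, n)`.

All tensors and spinors below are given by their components in this tetrad and spin frame. In
particular a weighted scalar field of conformal weight `w` and GHP weight `p` (a section of a line
bundle, which gets multiplied by `Ω ^ w * z ^ p` under `g → Ω² g`, `(o, ι) → (z o, z⁻¹ ι)`) is
given, for the chosen metric and spin frame, by a complex function. -/
structure NullTetrad (H : AlmostHermitian M) where
  /-- the domain of the tetrad -/
  domain : Set M
  isOpen_domain : IsOpen domain
  /-- the vector fields of the tetrad -/
  Z : Idx → CField M
  smooth_re : ∀ a, ∀ x ∈ domain, SmoothFieldAt (Z a).re x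
  smooth_im : ∀ a, ∀ x ∈ domain, SmoothFieldAt (Z a).im x
  normalized : ∀ a b, ∀ x ∈ domain, cinner H.g (Z a) (Z b) x = eta a b
  /-- `J Z = -i Z` for `Z = ℓ, m` -/
  eigen_minus : ∀ (A' : Fin 2), ∀ x ∈ domain,
    capply H.J (Z (0, A')) x = ((Z (0, A')).im x, -(Z (0, A')).re x)
  /-- `J Z = i Z` for `Z = m̃, n` -/
  eigen_plus : ∀ (A' : Fin 2), ∀ x ∈ domain,
    capply H.J (Z (1, A')) x = (-(Z (1, A')).im x, (Z (1, A')).re x)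

namespace NullTetrad

variable {H : AlmostHermitian M} (T : NullTetrad H)

/-! ### The Levi-Civita connection -/

/-- The directional derivative `Z_a(F)`. -/
def dir (a : Idx) (F : M → ℂ) (x : M) : ℂ := cdir (T.Z a) F x

/-- `conn a b c = g(∇_{Z_a} Z_b, Z_c)`. -/
def conn (a b c : Idx) (x : M) : ℂ := koszul H.g (T.Z a) (T.Z b) (T.Z c) x

/-- The connection coefficients `Γ_{ab}^c`: `∇_{Z_a} Z_b = Γ_{ab}^c Z_c`. -/
def Gam (a b c : Idx) (x : M) : ℂ := ∑ d, T.conn a b d x * eta d c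

/-- `∇_a v_b` for a covector field `v`. -/
def nablaCov (a b : Idx) (v : Idx → M → ℂ) (x : M) : ℂ :=
  T.dir a (v b) x - ∑ c, T.Gam a b c x * v c x

/-- The components `J^c_b`: `J Z_b = J^c_b Z_c`. -/
def Jc (c b : Idx) (x : M) : ℂ := ∑ d, eta c d * cinner H.g (T.Z d) (capply H.J (T.Z b)) x

/-- `∇_b J^c_a`. -/
def nablaJ (b c a : Idx) (x : M) : ℂ :=
  T.dir b (T.Jc c a) x + ∑ d, T.Gam b d c x * T.Jc d a x - ∑ d, T.Gam b a d x * T.Jc c d x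

/-- The Lee form `f_a = -½ J^b_c ∇_b J^c_a`. -/
def lee (a : Idx) (x : M) : ℂ := -(1 / 2) * ∑ b, ∑ c, T.Jc b c x * T.nablaJ b c a x

/-- The unprimed spin connection coefficients: `∇_a ε_B^D = γ_{aB}^C ε_C^D` for the spin frame
`ε_0 = o`, `ε_1 = ι`. Since `Γ_{a BB'}^{CC'} = γ_{aB}^C δ_{B'}^{C'} + γ'_{aB'}^{C'} δ_B^C` with
trace-free `γ, γ'`, they are given by a partial trace. -/
def spin (a : Idx) (B C : Fin 2) (x : M) : ℂ := (1 / 2) * ∑ B' : Fin 2, T.Gam a (B, B') (C, B') x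

/-- The primed spin connection coefficients. -/
def spinPrimed (a : Idx) (B' C' : Fin 2) (x : M) : ℂ :=
  (1 / 2) * ∑ B : Fin 2, T.Gam a (B, B') (B, C') x

/-- The GHP connection form `ω_a = ι_B ∇_a o^B`, where `ι_B = ε_{1B}`. -/
def omega (a : Idx) (x : M) : ℂ := ∑ B : Fin 2, eps 1 B * T.spin a 0 B x

/-- `P_a = ω_a - ½ i J^b_a f_b`. -/
def P (a : Idx) (x : M) : ℂ :=
  T.omega a x - (1 / 2) * Complex.I * ∑ b, T.Jc b a x * T.lee b x

/-! ### The connection `𝒞_a` on weighted fields, and the operators built from it -/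

/-- The form `w f_a + p P_a`. -/
def wform (w : ℝ) (p : ℤ) (a : Idx) (x : M) : ℂ := (w : ℂ) * T.lee a x + (p : ℂ) * T.P a x

/-- `𝒞_a ψ = ∇_a ψ + (w f_a + p P_a) ψ` for a scalar `ψ` of weights `(w, p)`. -/
def CScalar (w : ℝ) (p : ℤ) (a : Idx) (F : M → ℂ) (x : M) : ℂ :=
  T.dir a F x + T.wform w p a x * F x

/-- `𝒞_a v_b = ∇_a v_b + (w f_a + p P_a) v_b - (f_a v_b + f_b v_a - g_{ab} f^c v_c)` for a covector
`v` of weights `(w, p)`. -/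
def CCovector (w : ℝ) (p : ℤ) (a b : Idx) (v : Idx → M → ℂ) (x : M) : ℂ :=
  T.nablaCov a b v x + T.wform w p a x * v b x
    - (T.lee a x * v b x + T.lee b x * v a x
      - eta a b * ∑ c, ∑ d, eta c d * T.lee c x * v d x)

/-- `𝒞_{AA'} φ_{B'} = ∇_{AA'} φ_{B'} + (w f_{AA'} + p P_{AA'}) φ_{B'} - f_{AB'} φ_{A'}` for a primed
spinor `φ_{B'}` of weights `(w, p)`. -/
def CPrimed (w : ℝ) (p : ℤ) (A A' B' : Fin 2) (φ : Fin 2 → M → ℂ) (x : M) : ℂ :=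
  T.dir (A, A') (φ B') x - ∑ C', T.spinPrimed (A, A') B' C' x * φ C' x
    + T.wform w p (A, A') x * φ B' x - T.lee (A, B') x * φ A' x

/-- `□^𝒞 = g^{ab} 𝒞_a 𝒞_b` on scalars of weights `(w, p)`. -/
def boxC (w : ℝ) (p : ℤ) (F : M → ℂ) (x : M) : ℂ :=
  ∑ a, ∑ b, eta a b * T.CCovector w p a b (fun c => T.CScalar w p c F) x

/-- The wave operator `□ = g^{ab} ∇_a ∇_b` on scalars. -/
def box (F : M → ℂ) (x : M) : ℂ := ∑ a, ∑ b, eta a b * T.nablaCov a b (fun c => T.dir c F) x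

/-- `𝒞̃_{A'} = o^A 𝒞_{AA'}` on scalars of weights `(w, p)`; it takes values in the primed spinors of
weights `(w - ½, p + 1)`. -/
def dolT (w : ℝ) (p : ℤ) (F : M → ℂ) (A' : Fin 2) (x : M) : ℂ := T.CScalar w p (0, A') F x

/-- `𝒞_{A'} = ι^A 𝒞_{AA'}` on scalars of weights `(w, p)`; it takes values in the primed spinors of
weights `(w - ½, p - 1)`. -/
def dol (w : ℝ) (p : ℤ) (F : M → ℂ) (A' : Fin 2) (x : M) : ℂ := T.CScalar w p (1, A') F x

/-- `𝒞̃_{A'} φ_{B'} = o^A 𝒞_{AA'} φ_{B'}` on primed spinors of weights `(w, p)`. -/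
def dolTPrimed (w : ℝ) (p : ℤ) (φ : Fin 2 → M → ℂ) (A' B' : Fin 2) (x : M) : ℂ :=
  T.CPrimed w p 0 A' B' φ x

/-- `𝒞_{A'} φ_{B'} = ι^A 𝒞_{AA'} φ_{B'}` on primed spinors of weights `(w, p)`. -/
def dolPrimed (w : ℝ) (p : ℤ) (φ : Fin 2 → M → ℂ) (A' B' : Fin 2) (x : M) : ℂ :=
  T.CPrimed w p 1 A' B' φ x

/-- `𝒞^{A'} 𝒞̃_{A'} ψ = ε^{A'B'} 𝒞_{B'} 𝒞̃_{A'} ψ` for a scalar `ψ` of weights `(w, p)`. -/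
def dolDolT (w : ℝ) (p : ℤ) (F : M → ℂ) (x : M) : ℂ :=
  ∑ A', ∑ B', eps A' B' * T.dolPrimed (w - 1 / 2) (p + 1) (T.dolT w p F) B' A' x

/-- `[𝒞_{A'}, 𝒞̃^{A'}] ψ = ε^{A'B'} (𝒞_{A'} 𝒞̃_{B'} ψ - 𝒞̃_{B'} 𝒞_{A'} ψ)` for a scalar `ψ` of weights
`(w, p)`. -/
def dolCommutator (w : ℝ) (p : ℤ) (F : M → ℂ) (x : M) : ℂ :=
  ∑ A', ∑ B', eps A' B' *
    (T.dolPrimed (w - 1 / 2) (p + 1) (T.dolT w p F) A' B' x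
      - T.dolTPrimed (w - 1 / 2) (p - 1) (T.dol w p F) B' A' x)

/-! ### Newman–Penrose formalism -/

/-- index of `ℓ` -/
abbrev iL : Idx := (0, 0)
/-- index of `n` -/
abbrev iN : Idx := (1, 1)
/-- index of `m` -/
abbrev iM : Idx := (0, 1)
/-- index of `m̃` -/
abbrev iMt : Idx := (1, 0)

/-- `D = ℓ^a ∇_a` on functions. -/
def D (F : M → ℂ) (x : M) : ℂ := T.dir iL F x
/-- `D' = n^a ∇_a` on functions. -/
def DP (F : M → ℂ) (x : M) : ℂ := T.dir iN F x
/-- `δ = m^a ∇_a` on functions. -/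
def del (F : M → ℂ) (x : M) : ℂ := T.dir iM F x
/-- `δ' = m̃^a ∇_a` on functions. -/
def delP (F : M → ℂ) (x : M) : ℂ := T.dir iMt F x

/-- `W^a X^b ∇_b Y_a` for members `W, X, Y` of the tetrad
(the Ricci rotation coefficients). -/
def rot (W X Y : Idx) (x : M) : ℂ := T.conn X Y W x

/-- `κ = m^a D ℓ_a` -/
def kappa (x : M) : ℂ := T.rot iM iL iL x
/-- `σ = m^a δ ℓ_a` -/
def sigma (x : M) : ℂ := T.rot iM iM iL x
/-- `ρ = m^a δ' ℓ_a` -/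
def rho (x : M) : ℂ := T.rot iM iMt iL x
/-- `τ = m^a D' ℓ_a` -/
def tau (x : M) : ℂ := T.rot iM iN iL x
/-- `ε = ½ (n^a D ℓ_a + m^a D m̃_a)` -/
def epsilon (x : M) : ℂ := (1 / 2) * (T.rot iN iL iL x + T.rot iM iL iMt x)
/-- `β = ½ (n^a δ ℓ_a + m^a δ m̃_a)` -/
def beta (x : M) : ℂ := (1 / 2) * (T.rot iN iM iL x + T.rot iM iM iMt x)

/-- `κ' = m̃^a D' n_a` (the prime exchanges `ℓ` with `n` and `m` with `m̃`) -/
def kappaP (x : M) : ℂ := T.rot iMt iN iN x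
/-- `σ' = m̃^a δ' n_a` -/
def sigmaP (x : M) : ℂ := T.rot iMt iMt iN x
/-- `ρ' = m̃^a δ n_a` -/
def rhoP (x : M) : ℂ := T.rot iMt iM iN x
/-- `τ' = m̃^a D n_a` -/
def tauP (x : M) : ℂ := T.rot iMt iL iN x
/-- `ε' = ½ (ℓ^a D' n_a + m̃^a D' m_a)` -/
def epsilonP (x : M) : ℂ := (1 / 2) * (T.rot iL iN iN x + T.rot iMt iN iM x)
/-- `β' = ½ (ℓ^a δ' n_a + m̃^a δ' m_a)` -/
def betaP (x : M) : ℂ := (1 / 2) * (T.rot iL iMt iN x + T.rot iMt iMt iM x)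

/-- `ρ̃ = m̃^a δ ℓ_a` (the tilde exchanges `m` with `m̃`, i.e. primed with unprimed spinors) -/
def rhoT (x : M) : ℂ := T.rot iMt iM iL x
/-- `τ̃' = m^a D n_a` -/
def tauPT (x : M) : ℂ := T.rot iM iL iN x
/-- `ε̃ = ½ (n^a D ℓ_a + m̃^a D m_a)` -/
def epsilonT (x : M) : ℂ := (1 / 2) * (T.rot iN iL iL x + T.rot iMt iL iM x)
/-- `β̃' = ½ (ℓ^a δ n_a + m^a δ m̃_a)` -/
def betaPT (x : M) : ℂ := (1 / 2) * (T.rot iL iM iN x + T.rot iM iM iMt x)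

/-! ### Curvature -/

/-- `R_{abc}^d`, with the convention `(∇_a ∇_b - ∇_b ∇_a) V^d = R_{abc}^d V^c` (for
torsion-free `∇`). -/
def riemUp (a b c d : Idx) (x : M) : ℂ :=
  T.dir a (T.Gam b c d) x - T.dir b (T.Gam a c d) x
    + ∑ e, (T.Gam b c e x * T.Gam a e d x - T.Gam a c e x * T.Gam b e d x
      - (T.Gam a b e x - T.Gam b a e x) * T.Gam e c d x)

/-- `R_{abcd} = R_{abc}^e g_{ed}` -/
def riem (a b c d : Idx) (x : M) : ℂ := ∑ e, T.riemUp a b c e x * eta e d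

/-- `R_{ab} = R_{acb}^c` -/
def ricci (a b : Idx) (x : M) : ℂ := ∑ c, T.riemUp a c b c x

/-- The scalar curvature `R = g^{ab} R_{ab}`. With the present conventions, the usual ones for
two-component spinors, `R` is negative on round spheres, and `□ + R/6` is the conformal
Laplacian. -/
def scal (x : M) : ℂ := ∑ a, ∑ b, eta a b * T.ricci a b x

/-- The Weyl tensor: the trace-free part of `R_{abcd}`. -/
def weyl (a b c d : Idx) (x : M) : ℂ :=
  T.riem a b c d x
    - (1 / 2) * (T.ricci a c x * eta b d - T.ricci b c x * eta a d
      + eta a c * T.ricci b d x - eta b c * T.ricci a d x)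
    + (1 / 6) * T.scal x * (eta a c * eta b d - eta b c * eta a d)

/-- `Ψ₂ = Ψ_{ABCD} o^A o^B ι^C ι^D = C_{abcd} ℓ^a m^b m̃^c n^d` -/
def Psi2 (x : M) : ℂ := T.weyl iL iM iMt iN x

/-- The fundamental 2-form `g_{ac} J^c_b`. -/
def form (a b : Idx) (x : M) : ℂ := ∑ c, eta a c * T.Jc c b x

/-- The volume form `-½ ω ∧ ω` of the orientation for which the fundamental 2-form `ω` is
anti-self-dual. -/
def vol (a b c d : Idx) (x : M) : ℂ :=
  -(T.form a b x * T.form c d x - T.form a c x * T.form b d x + T.form a d x * T.form b c x)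

/-- `(*C)_{abcd} = ½ ε_{ab}^{ef} C_{efcd}` -/
def starWeyl (a b c d : Idx) (x : M) : ℂ :=
  (1 / 2) * ∑ e, ∑ f, (∑ e', ∑ f', T.vol a b e' f' x * eta e' e * eta f' f) * T.weyl e f c d x

/-! ### The Newman–Penrose form of `□^𝒞` and the Teukolsky operator -/

/-- The Newman–Penrose expression
`[D - (p-1)ε + ε̃ + (w - p/2 + 1)ρ - ρ̃][D' + pε' + (w + p/2)ρ']`
`- [δ - (p-1)β + β̃' + (w - p/2 + 1)τ - τ̃'][δ' + pβ' + (w + p/2)τ'] + (3/2)pΨ₂ - p(σσ' - κκ')`. -/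
def npExpr (w : ℝ) (p : ℤ) (F : M → ℂ) (x : M) : ℂ :=
  let G : M → ℂ := fun y =>
    T.DP F y + ((p : ℂ) * T.epsilonP y + ((w : ℂ) + (p : ℂ) / 2) * T.rhoP y) * F y
  let K : M → ℂ := fun y =>
    T.delP F y + ((p : ℂ) * T.betaP y + ((w : ℂ) + (p : ℂ) / 2) * T.tauP y) * F y
  (T.D G x + (-((p : ℂ) - 1) * T.epsilon x + T.epsilonT x
      + ((w : ℂ) - (p : ℂ) / 2 + 1) * T.rho x - T.rhoT x) * G x)
    - (T.del K x + (-((p : ℂ) - 1) * T.beta x + T.betaPT x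
      + ((w : ℂ) - (p : ℂ) / 2 + 1) * T.tau x - T.tauPT x) * K x)
    + (3 / 2) * (p : ℂ) * T.Psi2 x * F x
    - (p : ℂ) * (T.sigma x * T.sigmaP x - T.kappa x * T.kappaP x) * F x

/-- The Teukolsky operator of spin weight `s`:
`T_s = 2 { [D - (2s-1)ε + ε̃ - 2sρ - ρ̃][D' + 2sε' - ρ']`
`- [δ - (2s-1)β + β̃' - 2sτ - τ̃'][δ' + 2sβ' - τ'] - 2(s - ½)(s - 1)Ψ₂ }`. -/
def teukolsky (s : ℝ) (F : M → ℂ) (x : M) : ℂ :=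
  let G : M → ℂ := fun y => T.DP F y + (2 * (s : ℂ) * T.epsilonP y - T.rhoP y) * F y
  let K : M → ℂ := fun y => T.delP F y + (2 * (s : ℂ) * T.betaP y - T.tauP y) * F y
  2 * ((T.D G x + (-(2 * (s : ℂ) - 1) * T.epsilon x + T.epsilonT x
        - 2 * (s : ℂ) * T.rho x - T.rhoT x) * G x)
    - (T.del K x + (-(2 * (s : ℂ) - 1) * T.beta x + T.betaPT x
        - 2 * (s : ℂ) * T.tau x - T.tauPT x) * K x)
    - 2 * ((s : ℂ) - 1 / 2) * ((s : ℂ) - 1) * T.Psi2 x * F x)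

end NullTetrad

/-- The geometry is conformally self-dual, `*C_{abcd} = C_{abcd}`, for the orientation for which
the fundamental 2-form is anti-self-dual. -/
def AlmostHermitian.IsConformallySelfDual (H : AlmostHermitian M) : Prop :=
  ∀ (T : NullTetrad H), ∀ x ∈ T.domain, ∀ a b c d : Idx, T.starWeyl a b c d x = T.weyl a b c d x

end Tetrad

end AlmostHermitianNP

end

noncomputable section

namespace AlmostHermitianNP

open VectorField Set Filter Topology

/-! ### Derivatives along vector fields and the Lie bracket as a commutator. -/

section LieDerivative

variable {M : Type*} [TopologicalSpace M] [ChartedSpace E4 M] [IsManifold (𝓡 4) ∞ M]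
  {F : Type*} [NormedAddCommGroup F] [NormedSpace ℝ F]

/-! Everything is computed in components. In a null tetrad adapted to `J` the metric components are
constant and `J` is diagonal with eigenvalues ∓i. Hence the Koszul coefficients `conn a b c` are
skew in `b, c`, the components of the Lee form along ℓ, m, m̃, n are exactly ρ, τ, τ', ρ', and 𝒞_a
on scalars has the connection form (w ∓ p/2) f_a + p ω_a. In particular the two inner brackets of
the Newman–Penrose expression are 𝒞_n and 𝒞_m̃ (`wform_plus`, `lee_N`, `lee_Mt`).

The operator □^𝒞 contains the products 𝒞_ℓ𝒞_n, 𝒞_m𝒞_m̃ in both orders. The Newman–Penrose expression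
uses one order and 𝒞^{A'}𝒞̃_{A'} the other, so each differs from ½□^𝒞 by half of the curvature of 𝒞
contracted with the bivector n∧ℓ + m∧m̃, with opposite signs. That contraction needs three scalar
curvature identities: R(n,m̃,ℓ,m) = R(ℓ,m,n,m̃) = -Ψ₂ - R/12, which control the derivatives of f,
and `riem_anti_self_dual_trace`, which controls the derivative of ω. The part proportional to w
cancels in the difference of the first two; in the part proportional to p the scalar curvature
cancels, and p(3/2 Ψ₂ - (σσ' - κκ')) remains. This is the content of `boxC_eq_npExpr`, `dolDolT_eq`
and `dolCommutator_eq`.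

The remaining claims are specializations. Integrability of `J` makes the -i eigenbundle involutive,
whence κ = σ = 0. Conformal self-duality gives Ψ₂ = 0. In the conformally Kähler case f = d log φ
and κ = σ = 0; conjugating □ by φ^(w+1) then differs from □^𝒞 only by ∇·f + f·f, which the sum of
the first two curvature identities evaluates to -2Ψ₂ - R/6.

The curvature is defined from the coefficients alone, so its symmetries have to be derived. The
first Bianchi identity is the Jacobi identity of the tetrad fields, which in turn comes from the
action of the Lie bracket on functions as a commutator of derivations. -/

theorem isManifold_nat (n : ℕ) : IsManifold (𝓡 4) n M :=
  IsManifold.of_le (n := ∞) (by norm_cast; exact le_top)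

/-- Derivatives along vector fields, computed in a chart. -/
theorem fderiv_comp_extChartAt_symm_mpullbackWithin {G : M → F} {x y : M}
    (hy : y ∈ (extChartAt (𝓡 4) x).source)
    (hG : MDifferentiableAt (𝓡 4) 𝓘(ℝ, F) G y) (V : RField M) :
    fderiv ℝ (G ∘ (extChartAt (𝓡 4) x).symm) (extChartAt (𝓡 4) x y)
        (mpullbackWithin 𝓘(ℝ, E4) (𝓡 4) (extChartAt (𝓡 4) x).symm V (range (𝓡 4))
          (extChartAt (𝓡 4) x y))
      = mvfderiv (𝓡 4) G y (V y) := by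
  have : IsManifold (𝓡 4) 1 M := isManifold_nat 1
  set u := extChartAt (𝓡 4) x y with hu'
  have hu : u ∈ (extChartAt (𝓡 4) x).target := (extChartAt (𝓡 4) x).map_source hy
  have hyu : (extChartAt (𝓡 4) x).symm u = y := (extChartAt (𝓡 4) x).left_inv hy
  have hinv := isInvertible_mfderivWithin_extChartAt_symm (I := 𝓡 4) hu
  have hd := mdifferentiableWithinAt_extChartAt_symm (I := 𝓡 4) hu
  clear_value u
  subst hyu
  have h1 := mfderiv_comp_mfderivWithin u hG hd
    ((𝓡 4).uniqueMDiffOn u (extChartAt_target_subset_range x hu))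
  have h2 : fderiv ℝ (G ∘ (extChartAt (𝓡 4) x).symm) u
      = mfderivWithin 𝓘(ℝ, E4) 𝓘(ℝ, F) (G ∘ (extChartAt (𝓡 4) x).symm) (range (𝓡 4)) u := by
    have : range (𝓡 4) = (univ : Set E4) := (𝓡 4).range_eq_univ
    rw [this, mfderivWithin_univ, mfderiv_eq_fderiv]
  rw [h2, h1, mpullbackWithin_apply]
  obtain ⟨e, he⟩ := hinv
  rw [← he, ContinuousLinearMap.inverse_equiv]
  change mfderiv (𝓡 4) 𝓘(ℝ, F) G _ (e (e.symm _)) = _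
  rw [ContinuousLinearEquiv.apply_symm_apply]
  rfl

omit [IsManifold (𝓡 4) ∞ M] in
theorem contDiffAt_comp_extChartAt_symm {G : M → F} {x : M}
    (hG : ContMDiffAt (𝓡 4) 𝓘(ℝ, F) ∞ G x) :
    ContDiffAt ℝ ∞ (G ∘ (extChartAt (𝓡 4) x).symm) (extChartAt (𝓡 4) x x) := by
  have h := (contMDiffAt_iff.1 hG).2
  have : range (𝓡 4) = (univ : Set E4) := (𝓡 4).range_eq_univ
  rw [this] at h
  exact h

theorem SmoothFieldAt.contDiffAt_mpullbackWithin {V : RField M} {x : M} (hV : SmoothFieldAt V x) :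
    ContDiffAt ℝ ∞ (mpullbackWithin 𝓘(ℝ, E4) (𝓡 4) (extChartAt (𝓡 4) x).symm V (range (𝓡 4)))
      (extChartAt (𝓡 4) x x) := by
  have h := contMDiffWithinAt_mpullbackWithin_extChartAt_symm (I := 𝓡 4) (s := univ) (V := V)
    (n := ∞) (m := ∞) hV.contMDiffWithinAt uniqueMDiffOn_univ (mem_univ x) le_rfl
  have h2 := contMDiffWithinAt_vectorSpace_iff_contDiffWithinAt.1 h
  refine h2.contDiffAt ?_
  simpa using extChartAt_target_mem_nhds (I := 𝓡 4) x

theorem eventually_mdifferentiableAt {G : M → F} {x : M}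
    (hG : ContMDiffAt (𝓡 4) 𝓘(ℝ, F) ∞ G x) :
    ∀ᶠ y in 𝓝 x, MDifferentiableAt (𝓡 4) 𝓘(ℝ, F) G y := by
  have : IsManifold (𝓡 4) 1 M := isManifold_nat 1
  have h : ContMDiffAt (𝓡 4) 𝓘(ℝ, F) 1 G x := hG.of_le (by simp)
  filter_upwards [(contMDiffAt_iff_contMDiffAt_nhds (by simp)).1 h] with y hy
  exact hy.mdifferentiableAt one_ne_zero

/-- In a chart this is a smooth derivative applied to a smooth pulled-back field. It permits
iterated directional derivatives. -/
theorem contMDiffAt_mvfderiv {G : M → F} {V : RField M} {x : M}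
    (hG : ContMDiffAt (𝓡 4) 𝓘(ℝ, F) ∞ G x) (hV : SmoothFieldAt V x) :
    ContMDiffAt (𝓡 4) 𝓘(ℝ, F) ∞ (fun y => mvfderiv (𝓡 4) G y (V y)) x := by
  have h1 : ContDiffAt ℝ ∞ (fun u => fderiv ℝ (G ∘ (extChartAt (𝓡 4) x).symm) u
      (mpullbackWithin 𝓘(ℝ, E4) (𝓡 4) (extChartAt (𝓡 4) x).symm V (range (𝓡 4)) u))
      (extChartAt (𝓡 4) x x) :=
    ((contDiffAt_comp_extChartAt_symm hG).fderiv_right (m := ∞) (by simp)).clm_apply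
      hV.contDiffAt_mpullbackWithin
  have h2 := h1.contMDiffAt.comp x (contMDiffAt_extChartAt (I := 𝓡 4) (n := ∞))
  refine h2.congr_of_eventuallyEq ?_
  filter_upwards [extChartAt_source_mem_nhds (I := 𝓡 4) x, eventually_mdifferentiableAt hG]
    with y hy hGy
  exact (fderiv_comp_extChartAt_symm_mpullbackWithin hy hGy V).symm

/-- The tangent space at `x` is identified with the model space through the preferred chart at `x`,
so the derivative of that chart at its own base point is the identity. -/
theorem mfderiv_extChartAt_inverse_apply (x : M) (v : E4) :
    (mfderiv (𝓡 4) 𝓘(ℝ, E4) (extChartAt (𝓡 4) x) x).inverse v = v := by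
  have : IsManifold (𝓡 4) 1 M := isManifold_nat 1
  rw [mfderiv_extChartAt_self]
  exact congrArg (fun f : E4 →L[ℝ] E4 => f v) ContinuousLinearMap.inverse_id

/-- Vector fields act on functions as derivations, and the Lie bracket as the commutator. -/
theorem mvfderiv_mlieBracket {G : M → F} {V W : RField M} {x : M}
    (hG : ContMDiffAt (𝓡 4) 𝓘(ℝ, F) ∞ G x) (hV : SmoothFieldAt V x) (hW : SmoothFieldAt W x) :
    mvfderiv (𝓡 4) G x (mlieBracket (𝓡 4) V W x)
      = mvfderiv (𝓡 4) (fun y => mvfderiv (𝓡 4) G y (W y)) x (V x)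
        - mvfderiv (𝓡 4) (fun y => mvfderiv (𝓡 4) G y (V y)) x (W x) := by
  have : IsManifold (𝓡 4) 1 M := isManifold_nat 1
  have hx := mem_extChartAt_source (I := 𝓡 4) x
  -- The second derivatives are derivatives of a first derivative, so the chart expression of the
  -- latter is needed on a neighbourhood, not only at `x`.
  have key : ∀ V : RField M,
      (fun u => fderiv ℝ (G ∘ (extChartAt (𝓡 4) x).symm) u
        (mpullbackWithin 𝓘(ℝ, E4) (𝓡 4) (extChartAt (𝓡 4) x).symm V (range (𝓡 4)) u))
      =ᶠ[𝓝 (extChartAt (𝓡 4) x x)]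
        (fun y => mvfderiv (𝓡 4) G y (V y)) ∘ (extChartAt (𝓡 4) x).symm := by
    intro V
    have hc := (continuousAt_extChartAt_symm (I := 𝓡 4) x).tendsto
    rw [extChartAt_to_inv x] at hc
    filter_upwards [extChartAt_target_mem_nhds (I := 𝓡 4) x,
      hc.eventually (eventually_mdifferentiableAt hG)] with u hu hGu
    have := fderiv_comp_extChartAt_symm_mpullbackWithin
      ((extChartAt (𝓡 4) x).map_target hu) hGu V
    rwa [(extChartAt (𝓡 4) x).right_inv hu] at this
  have hdir : ∀ {V : RField M}, SmoothFieldAt V x →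
      MDifferentiableAt (𝓡 4) 𝓘(ℝ, F) (fun y => mvfderiv (𝓡 4) G y (V y)) x := fun hV =>
    (contMDiffAt_mvfderiv hG hV).mdifferentiableAt (by simp)
  rw [← fderiv_comp_extChartAt_symm_mpullbackWithin hx (hdir hW) V,
    ← fderiv_comp_extChartAt_symm_mpullbackWithin hx (hdir hV) W,
    ← (key W).fderiv_eq, ← (key V).fderiv_eq,
    ← fderiv_comp_extChartAt_symm_mpullbackWithin hx (hG.mdifferentiableAt (by simp)),
    ← fderiv_apply_lieBracket (contDiffAt_comp_extChartAt_symm hG)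
      (by simp only [minSmoothness_of_isRCLikeNormedField]; norm_cast)
      (hW.contDiffAt_mpullbackWithin.differentiableAt (by simp))
      (hV.contDiffAt_mpullbackWithin.differentiableAt (by simp))]
  congr 1
  -- The manifold bracket is defined through the bracket of the fields pulled back to this same
  -- chart; the chart derivatives relating the two are inverse to each other at the base point.
  rw [mpullbackWithin_apply, extChartAt_to_inv, ← mlieBracketWithin_univ, mlieBracketWithin_apply]
  refine (mfderivWithin_extChartAt_symm_inverse_apply (I := 𝓡 4) (x := x) _).trans ?_
  refine (mfderiv_extChartAt_inverse_apply x _).trans ?_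
  have hr : (extChartAt (𝓡 4) x).symm ⁻¹' univ ∩ range (𝓡 4) = (univ : Set E4) := by
    rw [preimage_univ, univ_inter, (𝓡 4).range_eq_univ]
  rw [hr]
  exact congrFun (lieBracketWithin_univ (𝕜 := ℝ) (E := E4)) _
end LieDerivative

/-! ### Complex vector fields, the Koszul formula and coordinate components. -/

section ComplexFields

variable {M : Type*} [TopologicalSpace M] [ChartedSpace E4 M]

/-- Smoothness at a point of complex functions. -/
abbrev SmoothFunAt (F : M → ℂ) (x : M) : Prop := ContMDiffAt (𝓡 4) 𝓘(ℝ, ℂ) ∞ F x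

theorem SmoothFunAt.mdifferentiableAt {F : M → ℂ} {x : M} (hF : SmoothFunAt F x) :
    MDifferentiableAt (𝓡 4) 𝓘(ℝ, ℂ) F x :=
  ContMDiffAt.mdifferentiableAt hF (by simp)

theorem cdir_add (V : CField M) {F G : M → ℂ} {x : M} (hF : SmoothFunAt F x)
    (hG : SmoothFunAt G x) :
    cdir V (fun y => F y + G y) x = cdir V F x + cdir V G x := by
  unfold cdir
  rw [mvfderiv_fun_add hF.mdifferentiableAt hG.mdifferentiableAt]
  simp only [add_apply]
  ring

theorem mvfderiv_mul_complex {F G : M → ℂ} {x : M} (hF : SmoothFunAt F x)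
    (hG : SmoothFunAt G x) (v : TangentSpace (𝓡 4) x) :
    mvfderiv (𝓡 4) (fun y => F y * G y) x v
      = mvfderiv (𝓡 4) F x v * G x + F x * mvfderiv (𝓡 4) G x v := by
  have h := (hF.mdifferentiableAt.hasMFDerivAt.mul hG.mdifferentiableAt.hasMFDerivAt).mfderiv
  have h2 : mvfderiv (𝓡 4) (fun y => F y * G y) x v
      = mfderiv (𝓡 4) 𝓘(ℝ, ℂ) (F * G) x v := rfl
  rw [h2, h]
  change F x * mvfderiv (𝓡 4) G x v + G x * mvfderiv (𝓡 4) F x v = _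
  ring

theorem SmoothFunAt.add {F G : M → ℂ} {x : M} (hF : SmoothFunAt F x) (hG : SmoothFunAt G x) :
    SmoothFunAt (fun y => F y + G y) x := ContMDiffAt.add hF hG

theorem SmoothFunAt.mul {F G : M → ℂ} {x : M} (hF : SmoothFunAt F x) (hG : SmoothFunAt G x) :
    SmoothFunAt (fun y => F y * G y) x :=
  (contDiff_mul (𝕜 := ℝ) (𝔸 := ℂ)).contMDiff.contMDiffAt.comp x (hF.prodMk_space hG)

theorem smoothFunAt_const (c : ℂ) (x : M) : SmoothFunAt (fun _ => c) x := contMDiffAt_const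

theorem cdir_mul (V : CField M) {F G : M → ℂ} {x : M} (hF : SmoothFunAt F x)
    (hG : SmoothFunAt G x) :
    cdir V (fun y => F y * G y) x = cdir V F x * G x + F x * cdir V G x := by
  unfold cdir
  rw [mvfderiv_mul_complex hF hG, mvfderiv_mul_complex hF hG]
  ring

theorem cdir_const (V : CField M) (c : ℂ) (x : M) : cdir V (fun _ => c) x = 0 := by
  simp [cdir, mvfderiv_const]

theorem cdir_congr (V : CField M) {F G : M → ℂ} {x : M} (h : F =ᶠ[𝓝 x] G) :
    cdir V F x = cdir V G x := by
  have : mvfderiv (𝓡 4) F x = mvfderiv (𝓡 4) G x := by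
    unfold mvfderiv
    rw [h.mfderiv_eq]
    ext v
    rfl
  rw [cdir, cdir, this]

variable [IsManifold (𝓡 4) ∞ M]

/-- A complex vector field is smooth at `x`. -/
def SmoothCFieldAt (V : CField M) (x : M) : Prop := SmoothFieldAt V.re x ∧ SmoothFieldAt V.im x

theorem SmoothCFieldAt.smoothFunAt_cdir {V : CField M} {F : M → ℂ} {x : M}
    (hV : SmoothCFieldAt V x) (hF : SmoothFunAt F x) : SmoothFunAt (cdir V F) x :=
  SmoothFunAt.add (contMDiffAt_mvfderiv hF hV.1)
    ((smoothFunAt_const Complex.I x).mul (contMDiffAt_mvfderiv hF hV.2))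

theorem cdir_cbracket {V W : CField M} {F : M → ℂ} {x : M} (hV : SmoothCFieldAt V x)
    (hW : SmoothCFieldAt W x) (hF : SmoothFunAt F x) :
    cdir (cbracket V W) F x = cdir V (cdir W F) x - cdir W (cdir V F) x := by
  have hd : ∀ {X : RField M}, SmoothFieldAt X x →
      SmoothFunAt (fun y => mvfderiv (𝓡 4) F y (X y)) x := fun hX => contMDiffAt_mvfderiv hF hX
  have hI : SmoothFunAt (fun _ : M => Complex.I) x := smoothFunAt_const _ x
  have key : ∀ {U W : CField M}, SmoothCFieldAt W x → cdir U (cdir W F) x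
      = cdir U (fun y => mvfderiv (𝓡 4) F y (W.re y)) x
        + Complex.I * cdir U (fun y => mvfderiv (𝓡 4) F y (W.im y)) x := by
    intro U W hW
    have := cdir_add U (hd hW.1) (hI.mul (hd hW.2))
    refine this.trans ?_
    have h2 := cdir_mul U hI (hd hW.2)
    rw [cdir_const, zero_mul, zero_add] at h2
    rw [← h2]
  rw [key hW, key hV]
  have e1 : (cbracket V W).re x
    = mlieBracket (𝓡 4) V.re W.re x - mlieBracket (𝓡 4) V.im W.im x := rfl
  have e2 : (cbracket V W).im x
    = mlieBracket (𝓡 4) V.re W.im x + mlieBracket (𝓡 4) V.im W.re x := rfl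
  rw [cdir, e1, e2, map_sub, map_add, mvfderiv_mlieBracket hF hV.1 hW.1,
    mvfderiv_mlieBracket hF hV.2 hW.2, mvfderiv_mlieBracket hF hV.1 hW.2,
    mvfderiv_mlieBracket hF hV.2 hW.1]
  simp only [cdir]
  ring_nf
  simp only [Complex.I_sq]
  ring

theorem SmoothFieldAt.add {X Y : RField M} {x : M} (hX : SmoothFieldAt X x)
    (hY : SmoothFieldAt Y x) : SmoothFieldAt (fun y => X y + Y y) x :=
  ContMDiffAt.add_section hX hY

theorem SmoothFieldAt.sub {X Y : RField M} {x : M} (hX : SmoothFieldAt X x)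
    (hY : SmoothFieldAt Y x) : SmoothFieldAt (fun y => X y - Y y) x :=
  ContMDiffAt.sub_section hX hY

theorem SmoothFieldAt.mlieBracket {X Y : RField M} {x : M} (hX : SmoothFieldAt X x)
    (hY : SmoothFieldAt Y x) : SmoothFieldAt (mlieBracket (𝓡 4) X Y) x := by
  have : IsManifold (𝓡 4) ((⊤ : ℕ∞) + 1) M := by simpa
  have : IsManifold (𝓡 4) (minSmoothness ℝ 2) M := by
    simpa using isManifold_nat (M := M) 2
  have : IsManifold (𝓡 4) (minSmoothness ℝ 3) M := by
    simpa using isManifold_nat (M := M) 3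
  exact ContMDiffAt.mlieBracket_vectorField (n := ⊤) (m := ⊤) hX hY (by simp)

theorem SmoothCFieldAt.cbracket {V W : CField M} {x : M} (hV : SmoothCFieldAt V x)
    (hW : SmoothCFieldAt W x) : SmoothCFieldAt (cbracket V W) x :=
  ⟨(hV.1.mlieBracket hW.1).sub (hV.2.mlieBracket hW.2),
    (hV.1.mlieBracket hW.2).add (hV.2.mlieBracket hW.1)⟩

theorem cinner_comm {H : AlmostHermitian M} (V W : CField M) (x : M) :
    cinner H.g V W x = cinner H.g W V x := by
  have : ∀ v w, H.g x v w = H.g x w v := H.metric.symm x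
  unfold cinner
  rw [this (V.re x) (W.re x), this (V.im x) (W.im x), this (V.re x) (W.im x),
    this (V.im x) (W.re x), add_comm (H.g x (W.im x) (V.re x))]

theorem smoothAt_metric (H : AlmostHermitian M) {X Y : RField M} {x : M} (hX : SmoothFieldAt X x)
    (hY : SmoothFieldAt Y x) : ContMDiffAt (𝓡 4) 𝓘(ℝ, ℝ) ∞ (fun y => H.g y (X y) (Y y)) x := by
  have h : ContMDiffAt (𝓡 4) ((𝓡 4).prod 𝓘(ℝ, ℝ)) ∞
      (fun y => Bundle.TotalSpace.mk' ℝ (E := Bundle.Trivial M ℝ) y (H.g y (X y) (Y y))) x :=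
    ContMDiffAt.clm_bundle_apply₂ (F₁ := E4) (F₂ := E4) H.metric.contMDiff.contMDiffAt hX hY
  simp only [Bundle.contMDiffAt_totalSpace] at h
  exact h.2

omit [IsManifold (𝓡 4) ∞ M] in
theorem smoothFunAt_mk {f g : M → ℝ} {x : M} (hf : ContMDiffAt (𝓡 4) 𝓘(ℝ, ℝ) ∞ f x)
    (hg : ContMDiffAt (𝓡 4) 𝓘(ℝ, ℝ) ∞ g x) : SmoothFunAt (fun y => (⟨f y, g y⟩ : ℂ)) x := by
  have h : ∀ {f : M → ℝ}, ContMDiffAt (𝓡 4) 𝓘(ℝ, ℝ) ∞ f x → SmoothFunAt (fun y => (f y : ℂ)) x :=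
    fun hf => Complex.ofRealCLM.contDiff.contMDiff.contMDiffAt.comp x hf
  have := (h hf).add ((h hg).mul (smoothFunAt_const Complex.I x))
  refine this.congr_of_eventuallyEq (Eventually.of_forall fun y => ?_)
  simp [Complex.mk_eq_add_mul_I]

theorem smoothFunAt_cinner (H : AlmostHermitian M) {V W : CField M} {x : M}
    (hV : SmoothCFieldAt V x) (hW : SmoothCFieldAt W x) : SmoothFunAt (cinner H.g V W) x :=
  smoothFunAt_mk ((smoothAt_metric H hV.1 hW.1).sub (smoothAt_metric H hV.2 hW.2))
    ((smoothAt_metric H hV.1 hW.2).add (smoothAt_metric H hV.2 hW.1))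

omit [IsManifold (𝓡 4) ∞ M] in
theorem cinner_cbracket_swap (g : BilinField M) (V W U : CField M) (x : M) :
    cinner g (cbracket V W) U x = -cinner g (cbracket W V) U x := by
  have e1 : (cbracket V W).re x = -(cbracket W V).re x := by
    change mlieBracket (𝓡 4) V.re W.re x - mlieBracket (𝓡 4) V.im W.im x
      = -(mlieBracket (𝓡 4) W.re V.re x - mlieBracket (𝓡 4) W.im V.im x)
    rw [mlieBracket_swap_apply (V := V.re), mlieBracket_swap_apply (V := V.im)]
    abel
  have e2 : (cbracket V W).im x = -(cbracket W V).im x := by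
    change mlieBracket (𝓡 4) V.re W.im x + mlieBracket (𝓡 4) V.im W.re x
      = -(mlieBracket (𝓡 4) W.re V.im x + mlieBracket (𝓡 4) W.im V.re x)
    rw [mlieBracket_swap_apply (V := V.re), mlieBracket_swap_apply (V := V.im)]
    abel
  unfold cinner
  rw [e1, e2]
  apply Complex.ext <;> simp <;> ring

/-- Metric compatibility of the Levi-Civita connection, read off the Koszul formula. -/
theorem koszul_add_koszul (H : AlmostHermitian M) (X Y Z : CField M) (x : M) :
    koszul H.g X Y Z x + koszul H.g X Z Y x = cdir X (cinner H.g Y Z) x := by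
  have hs : ∀ V W : CField M, cinner H.g V W = cinner H.g W V :=
    fun V W => funext fun x => cinner_comm V W x
  unfold koszul
  rw [cinner_cbracket_swap H.g Z Y X, hs Z Y, hs X Z, hs X Y]
  ring

/-- Vanishing torsion of the Levi-Civita connection, read off the Koszul formula. -/
theorem koszul_sub_koszul (H : AlmostHermitian M) (X Y Z : CField M) (x : M) :
    koszul H.g X Y Z x - koszul H.g Y X Z x = cinner H.g (cbracket X Y) Z x := by
  have hs : ∀ V W : CField M, cinner H.g V W = cinner H.g W V :=
    fun V W => funext fun x => cinner_comm V W x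
  unfold koszul
  rw [cinner_cbracket_swap H.g Y X Z, hs Y X]
  ring

/-! ### Components -/

/-- The coordinates of a tangent vector in the preferred chart at its base point. -/
def tangentCoord {x : M} (v : TangentSpace (𝓡 4) x) (i : Fin 4) : ℝ :=
  EuclideanSpace.equiv (Fin 4) ℝ v i

/-- The coordinate vectors of the preferred chart at `x`. -/
def tangentBasis (x : M) (i : Fin 4) : TangentSpace (𝓡 4) x :=
  (EuclideanSpace.single i (1 : ℝ) : E4)

omit [IsManifold (𝓡 4) ∞ M] in
theorem sum_tangentCoord {x : M} (v : TangentSpace (𝓡 4) x) :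
    ∑ i, tangentCoord v i • tangentBasis x i = v := by
  have := (EuclideanSpace.basisFun (Fin 4) ℝ).sum_repr v
  simp only [EuclideanSpace.basisFun_apply] at this
  exact this

/-- The components of a complex vector field at `x` in the preferred chart at `x`. -/
def comp (V : CField M) (x : M) (i : Fin 4) : ℂ :=
  ⟨tangentCoord (V.re x) i, tangentCoord (V.im x) i⟩

omit [IsManifold (𝓡 4) ∞ M] in
theorem cdir_eq_sum (V : CField M) (F : M → ℂ) (x : M) :
    cdir V F x = ∑ i, comp V x i * mvfderiv (𝓡 4) F x (tangentBasis x i) := by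
  have h : ∀ v, mvfderiv (𝓡 4) F x v
      = ∑ i, (tangentCoord v i : ℂ) * mvfderiv (𝓡 4) F x (tangentBasis x i) := by
    intro v
    conv_lhs => rw [← sum_tangentCoord v]
    simp only [map_sum, map_smul, Complex.real_smul]
  unfold cdir
  rw [h (V.re x), h (V.im x), Finset.mul_sum, ← Finset.sum_add_distrib]
  refine Finset.sum_congr rfl fun i _ => ?_
  rw [comp, Complex.mk_eq_add_mul_I]
  ring

omit [IsManifold (𝓡 4) ∞ M] in
theorem cinner_eq_sum (g : BilinField M) (V W : CField M) (x : M) :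
    cinner g V W x = ∑ i, ∑ j, comp V x i * comp W x j *
      ((g x (tangentBasis x i) (tangentBasis x j) : ℝ) : ℂ) := by
  have h : ∀ v w, g x v w = ∑ i, ∑ j, tangentCoord v i * tangentCoord w j *
      g x (tangentBasis x i) (tangentBasis x j) := by
    intro v w
    conv_lhs => rw [← sum_tangentCoord v, ← sum_tangentCoord w]
    simp only [map_sum, map_smul, sum_apply, smul_apply, smul_eq_mul, Finset.mul_sum]
    rw [Finset.sum_comm]
    refine Finset.sum_congr rfl fun i _ => Finset.sum_congr rfl fun j _ => ?_
    ring
  unfold cinner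
  rw [h (V.re x) (W.re x), h (V.im x) (W.im x), h (V.re x) (W.im x), h (V.im x) (W.re x)]
  simp only [← Finset.sum_sub_distrib, ← Finset.sum_add_distrib]
  apply Complex.ext
  · simp only [Complex.re_sum]
    refine Finset.sum_congr rfl fun i _ => Finset.sum_congr rfl fun j _ => ?_
    simp [comp]
    ring
  · simp only [Complex.im_sum]
    refine Finset.sum_congr rfl fun i _ => Finset.sum_congr rfl fun j _ => ?_
    simp [comp]
    ring

end ComplexFields

/-! ### The tetrad as a frame, its structure functions and the Jacobi identity. -/

namespace NullTetrad

section Frame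

variable {M : Type*} [TopologicalSpace M] [ChartedSpace E4 M] [IsManifold (𝓡 4) ∞ M]
  {H : AlmostHermitian M} (T : NullTetrad H)

/-- Smoothness on the domain of the tetrad. -/
def Smooth (F : M → ℂ) : Prop := ∀ x ∈ T.domain, SmoothFunAt F x

variable {T}

theorem smooth_of_contMDiffOn {F : M → ℂ} (hF : ContMDiffOn (𝓡 4) 𝓘(ℝ, ℂ) ∞ F T.domain) :
    T.Smooth F := fun x hx => (hF x hx).contMDiffAt (T.isOpen_domain.mem_nhds hx)

theorem Smooth.add {F G : M → ℂ} (hF : T.Smooth F) (hG : T.Smooth G) :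
    T.Smooth (fun y => F y + G y) := fun x hx => (hF x hx).add (hG x hx)

theorem Smooth.mul {F G : M → ℂ} (hF : T.Smooth F) (hG : T.Smooth G) :
    T.Smooth (fun y => F y * G y) := fun x hx => (hF x hx).mul (hG x hx)

theorem smooth_const (c : ℂ) : T.Smooth (fun _ => c) := fun x _ => smoothFunAt_const c x

theorem Smooth.neg {F : M → ℂ} (hF : T.Smooth F) : T.Smooth (fun y => -F y) := by
  simpa using (smooth_const (-1)).mul hF

theorem Smooth.sub {F G : M → ℂ} (hF : T.Smooth F) (hG : T.Smooth G) :
    T.Smooth (fun y => F y - G y) := by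
  simpa [sub_eq_add_neg] using hF.add hG.neg

theorem Smooth.sum {ι : Type*} {s : Finset ι} {F : ι → M → ℂ} (hF : ∀ i ∈ s, T.Smooth (F i)) :
    T.Smooth (fun y => ∑ i ∈ s, F i y) := by
  classical
  induction s using Finset.induction_on with
  | empty => simpa using smooth_const 0
  | insert a s ha ih =>
    simp only [Finset.sum_insert ha]
    exact (hF a (by simp)).add (ih fun i hi => hF i (by simp [hi]))

theorem eventuallyEq_of_domain {F G : M → ℂ} (h : ∀ y ∈ T.domain, F y = G y) {x : M}
    (hx : x ∈ T.domain) : F =ᶠ[𝓝 x] G :=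
  Filter.eventuallyEq_of_mem (T.isOpen_domain.mem_nhds hx) h

theorem Smooth.congr {F G : M → ℂ} (hF : T.Smooth F) (h : ∀ y ∈ T.domain, G y = F y) :
    T.Smooth G := fun x hx => (hF x hx).congr_of_eventuallyEq (eventuallyEq_of_domain h hx)

theorem smoothCFieldAt (a : Idx) {x : M} (hx : x ∈ T.domain) : SmoothCFieldAt (T.Z a) x :=
  ⟨T.smooth_re a x hx, T.smooth_im a x hx⟩

theorem Smooth.dir {F : M → ℂ} (hF : T.Smooth F) (a : Idx) : T.Smooth (T.dir a F) :=
  fun x hx => (smoothCFieldAt a hx).smoothFunAt_cdir (hF x hx)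

theorem dir_congr {F G : M → ℂ} (h : ∀ y ∈ T.domain, F y = G y) (a : Idx) {x : M}
    (hx : x ∈ T.domain) : T.dir a F x = T.dir a G x :=
  cdir_congr _ (eventuallyEq_of_domain h hx)

@[simp] theorem dir_const (a : Idx) (c : ℂ) (x : M) : T.dir a (fun _ => c) x = 0 :=
  cdir_const _ c x

theorem dir_add (a : Idx) {F G : M → ℂ} (hF : T.Smooth F) (hG : T.Smooth G) {x : M}
    (hx : x ∈ T.domain) : T.dir a (fun y => F y + G y) x = T.dir a F x + T.dir a G x :=
  cdir_add _ (hF x hx) (hG x hx)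

theorem dir_mul (a : Idx) {F G : M → ℂ} (hF : T.Smooth F) (hG : T.Smooth G) {x : M}
    (hx : x ∈ T.domain) :
    T.dir a (fun y => F y * G y) x = T.dir a F x * G x + F x * T.dir a G x :=
  cdir_mul _ (hF x hx) (hG x hx)

theorem dir_const_mul (a : Idx) (c : ℂ) {F : M → ℂ} (hF : T.Smooth F) {x : M}
    (hx : x ∈ T.domain) : T.dir a (fun y => c * F y) x = c * T.dir a F x := by
  rw [dir_mul a (smooth_const c) hF hx, dir_const, zero_mul, zero_add]

theorem dir_neg (a : Idx) {F : M → ℂ} (hF : T.Smooth F) {x : M}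
    (hx : x ∈ T.domain) : T.dir a (fun y => -F y) x = -T.dir a F x := by
  simpa using dir_const_mul a (-1) hF hx

theorem dir_sub (a : Idx) {F G : M → ℂ} (hF : T.Smooth F) (hG : T.Smooth G) {x : M}
    (hx : x ∈ T.domain) : T.dir a (fun y => F y - G y) x = T.dir a F x - T.dir a G x := by
  simpa [sub_eq_add_neg, dir_neg a hG hx] using dir_add a hF hG.neg hx

theorem dir_sum (a : Idx) {ι : Type*} {s : Finset ι} {F : ι → M → ℂ}
    (hF : ∀ i ∈ s, T.Smooth (F i)) {x : M} (hx : x ∈ T.domain) :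
    T.dir a (fun y => ∑ i ∈ s, F i y) x = ∑ i ∈ s, T.dir a (F i) x := by
  classical
  induction s using Finset.induction_on with
  | empty => simp
  | insert b s hb ih =>
    simp only [Finset.sum_insert hb]
    rw [dir_add a (hF b (by simp)) (Smooth.sum fun i hi => hF i (by simp [hi])) hx,
      ih fun i hi => hF i (by simp [hi])]

/-! ### The tetrad as a basis -/

open Matrix in
/-- The rows of component vectors of the tetrad have a left inverse. -/
theorem comp_dual_mul_comp {x : M} (hx : x ∈ T.domain) (i k : Fin 4) :
    ∑ c, (∑ d, (∑ j, ((H.g x (tangentBasis x i) (tangentBasis x j) : ℝ) : ℂ) * comp (T.Z d) x j)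
      * eta d c) * comp (T.Z c) x k = if i = k then 1 else 0 := by
  let A : Matrix Idx (Fin 4) ℂ := Matrix.of fun a i => comp (T.Z a) x i
  let g : Matrix (Fin 4) (Fin 4) ℂ :=
    Matrix.of fun i j => ((H.g x (tangentBasis x i) (tangentBasis x j) : ℝ) : ℂ)
  let e : Matrix Idx Idx ℂ := Matrix.of eta
  have h1 : A * g * Aᵀ = e := by
    ext a b
    have h := T.normalized a b x hx
    rw [cinner_eq_sum] at h
    simp only [Matrix.mul_apply, Matrix.transpose_apply, Finset.sum_mul, A, g, e, Matrix.of_apply]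
    rw [Finset.sum_comm, ← h]
    refine Finset.sum_congr rfl fun i _ => Finset.sum_congr rfl fun j _ => ?_
    ring
  have h2 : e * e = 1 := by
    ext a c
    simp only [Matrix.mul_apply, e, Matrix.of_apply, Matrix.one_apply]
    exact eta_inv a c
  have h3 : A * (g * Aᵀ * e) = 1 := by
    rw [← Matrix.mul_assoc, ← Matrix.mul_assoc, h1, h2]
  -- There are as many tetrad members as dimensions, so a right inverse of the component matrix is
  -- also a left inverse.
  have h4 : (g * Aᵀ * e) * A = 1 := by
    have hc : Fintype.card Idx = Fintype.card (Fin 4) := by simp [Idx]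
    exact (Matrix.mul_eq_one_comm_of_card_eq _ _ _ hc).1 h3
  have h5 := congrFun (congrFun h4 i) k
  simp only [Matrix.mul_apply, Matrix.transpose_apply, A, g, e, Matrix.of_apply,
    Matrix.one_apply] at h5
  exact h5

/-- Expansion of a complex vector field in the tetrad. -/
theorem cdir_eq_sum_dir (V : CField M) (F : M → ℂ) {x : M} (hx : x ∈ T.domain) :
    cdir V F x = ∑ c, (∑ d, cinner H.g V (T.Z d) x * eta d c) * T.dir c F x := by
  have hV : ∀ k, comp V x k
      = ∑ c, (∑ d, cinner H.g V (T.Z d) x * eta d c) * comp (T.Z c) x k := by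
    intro k
    have h : comp V x k = ∑ i, comp V x i * (if i = k then 1 else 0) := by simp
    rw [h]
    simp only [← comp_dual_mul_comp hx, cinner_eq_sum, Finset.mul_sum, Finset.sum_mul]
    rw [Finset.sum_comm]
    refine Finset.sum_congr rfl fun c _ => ?_
    rw [Finset.sum_comm]
    refine Finset.sum_congr rfl fun d _ => Finset.sum_congr rfl fun i _ =>
      Finset.sum_congr rfl fun j _ => ?_
    ring
  simp only [dir, cdir_eq_sum, hV, Finset.sum_mul, Finset.mul_sum]
  rw [Finset.sum_comm]
  refine Finset.sum_congr rfl fun c _ => Finset.sum_congr rfl fun i _ =>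
    Finset.sum_congr rfl fun j _ => ?_
  ring

/-- The coordinate functions of the preferred chart at `x`. -/
def coordFun (x : M) (i : Fin 4) (y : M) : ℂ :=
  ((EuclideanSpace.equiv (Fin 4) ℝ (extChartAt (𝓡 4) x y) i : ℝ) : ℂ)

omit [IsManifold (𝓡 4) ∞ M] in
/-- A coordinate of the model space, as a complex-valued linear function. -/
theorem coordFun_eq (x : M) (i : Fin 4) :
    coordFun x i = (Complex.ofRealCLM.comp ((ContinuousLinearMap.proj i).comp
      (EuclideanSpace.equiv (Fin 4) ℝ).toContinuousLinearMap)) ∘ extChartAt (𝓡 4) x := rfl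

theorem smoothFunAt_coordFun {x y : M} (hy : y ∈ (chartAt E4 x).source) (i : Fin 4) :
    SmoothFunAt (coordFun x i) y := by
  rw [coordFun_eq]
  exact (ContinuousLinearMap.contDiff _).contMDiff.contMDiffAt.comp y (contMDiffAt_extChartAt' hy)

theorem mvfderiv_coordFun (x : M) (i : Fin 4) (v : TangentSpace (𝓡 4) x) :
    mvfderiv (𝓡 4) (coordFun x i) x v = (tangentCoord v i : ℂ) := by
  have : IsManifold (𝓡 4) 1 M := isManifold_nat 1
  have h := mfderiv_comp x (I := 𝓡 4) (I' := 𝓘(ℝ, E4)) (I'' := 𝓘(ℝ, ℂ))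
    (g := (Complex.ofRealCLM.comp ((ContinuousLinearMap.proj i).comp
      (EuclideanSpace.equiv (Fin 4) ℝ).toContinuousLinearMap)))
    (f := extChartAt (𝓡 4) x) (ContinuousLinearMap.mdifferentiableAt _)
    (mdifferentiableAt_extChartAt (mem_chart_source _ x))
  rw [← coordFun_eq, mfderiv_extChartAt_self, ContinuousLinearMap.mfderiv_eq] at h
  change mfderiv (𝓡 4) 𝓘(ℝ, ℂ) (coordFun x i) x v = _
  rw [h]
  rfl

theorem cdir_coordFun (V : CField M) (x : M) (i : Fin 4) :
    cdir V (coordFun x i) x = comp V x i := by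
  rw [cdir, mvfderiv_coordFun, mvfderiv_coordFun, comp, Complex.mk_eq_add_mul_I, mul_comm]

/-- The tetrad is linearly independent. -/
theorem eq_zero_of_sum_dir_eq_zero {x : M} (hx : x ∈ T.domain) (X : Idx → ℂ)
    (h : ∀ F : M → ℂ, (∀ᶠ y in 𝓝 x, SmoothFunAt F y) → ∑ c, X c * T.dir c F x = 0) (a : Idx) : X a = 0 := by
  -- Coordinate functions serve as test functions. They are smooth only near `x`, which is why the
  -- hypothesis asks for no more.
  have h1 : ∀ i, ∑ c, X c * comp (T.Z c) x i = 0 := fun i => by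
    rw [← h _ (Filter.mem_of_superset (chart_source_mem_nhds E4 x)
      fun y hy => smoothFunAt_coordFun hy i)]
    simp only [dir, cdir_coordFun]
  have h2 : ∀ d, ∑ b, X b * eta b d = 0 := by
    intro d
    simp only [← T.normalized _ d x hx, cinner_eq_sum, Finset.mul_sum]
    rw [Finset.sum_comm]
    refine Finset.sum_eq_zero fun i _ => ?_
    rw [Finset.sum_comm]
    refine Finset.sum_eq_zero fun j _ => ?_
    have := congrArg (· * (comp (T.Z d) x j *
      ((H.g x (tangentBasis x i) (tangentBasis x j) : ℝ) : ℂ))) (h1 i)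
    simp only [zero_mul, Finset.sum_mul] at this
    rw [← this]
    exact Finset.sum_congr rfl fun b _ => by ring
  have h3 : X a = ∑ b, X b * (if b = a then 1 else 0) := by simp
  rw [h3]
  simp only [← eta_inv, Finset.mul_sum]
  rw [Finset.sum_comm]
  refine Finset.sum_eq_zero fun d _ => ?_
  rw [← zero_mul (eta d a), ← h2 d, Finset.sum_mul]
  exact Finset.sum_congr rfl fun b _ => by ring

/-! ### The connection coefficients -/

theorem dir_cinner_eq_zero (a b c : Idx) {x : M} (hx : x ∈ T.domain) :
    cdir (T.Z a) (cinner H.g (T.Z b) (T.Z c)) x = 0 :=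
  (dir_congr (G := fun _ => eta b c) (fun y hy => T.normalized b c y hy) a hx).trans
    (dir_const a _ x)

theorem conn_antisymm (a b c : Idx) {x : M} (hx : x ∈ T.domain) :
    T.conn a c b x = -T.conn a b c x := by
  have h := koszul_add_koszul H (T.Z a) (T.Z b) (T.Z c) x
  rw [dir_cinner_eq_zero a b c hx] at h
  exact eq_neg_of_add_eq_zero_right h

/-- The inner products of tetrad members are constant, so only the bracket terms of the Koszul
formula survive on the domain. -/
theorem smooth_conn (a b c : Idx) : T.Smooth (T.conn a b c) := by
  have hb : ∀ a b c, T.Smooth (cinner H.g (cbracket (T.Z a) (T.Z b)) (T.Z c)) := fun a b c x hx =>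
    smoothFunAt_cinner H ((smoothCFieldAt a hx).cbracket (smoothCFieldAt b hx))
      (smoothCFieldAt c hx)
  refine Smooth.congr ((smooth_const (1 / 2)).mul (((hb a b c).sub (hb a c b)).sub (hb b c a)))
    fun x hx => ?_
  rw [conn, koszul, dir_cinner_eq_zero _ _ _ hx, dir_cinner_eq_zero _ _ _ hx,
    dir_cinner_eq_zero _ _ _ hx]
  ring

theorem smooth_Gam (a b c : Idx) : T.Smooth (T.Gam a b c) :=
  Smooth.sum fun d _ => (smooth_conn a b d).mul (smooth_const _)

variable (T) in
/-- The structure functions of the tetrad: `[Z_a, Z_b] = C_{ab}^c Z_c`. -/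
def struc (a b c : Idx) (x : M) : ℂ := T.Gam a b c x - T.Gam b a c x

theorem smooth_struc (a b c : Idx) : T.Smooth (T.struc a b c) :=
  (smooth_Gam a b c).sub (smooth_Gam b a c)

theorem dir_dir_sub (a b : Idx) {F : M → ℂ} (hF : T.Smooth F) {x : M} (hx : x ∈ T.domain) :
    T.dir a (T.dir b F) x - T.dir b (T.dir a F) x = ∑ c, T.struc a b c x * T.dir c F x := by
  have h := cdir_cbracket (smoothCFieldAt a hx) (smoothCFieldAt b hx) (hF x hx)
  rw [cdir_eq_sum_dir _ _ hx] at h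
  refine h.symm.trans (Finset.sum_congr rfl fun c _ => ?_)
  simp only [← koszul_sub_koszul, struc, Gam, conn, sub_mul, Finset.sum_sub_distrib]

variable (T) in
/-- The restriction of a tetrad to an open set. -/
def restrict (U : Set M) (hU : IsOpen U) : NullTetrad H where
  domain := T.domain ∩ U
  isOpen_domain := T.isOpen_domain.inter hU
  Z := T.Z
  smooth_re a x hx := T.smooth_re a x hx.1
  smooth_im a x hx := T.smooth_im a x hx.1
  normalized a b x hx := T.normalized a b x hx.1
  eigen_minus a x hx := T.eigen_minus a x hx.1
  eigen_plus a x hx := T.eigen_plus a x hx.1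

/-- The double bracket [Z_a, [Z_b, Z_c]] acting on `F`: once as iterated derivatives, once expanded
in the tetrad with the Leibniz rule applied to the structure functions. -/
theorem dir_dir_dir_sub (a b c : Idx) {F : M → ℂ} (hF : T.Smooth F) {x : M} (hx : x ∈ T.domain) :
    T.dir a (T.dir b (T.dir c F)) x - T.dir a (T.dir c (T.dir b F)) x
      - (T.dir b (T.dir c (T.dir a F)) x - T.dir c (T.dir b (T.dir a F)) x)
    = ∑ d, (T.dir a (T.struc b c d) x + ∑ e, T.struc b c e x * T.struc a e d x)
        * T.dir d F x := by
  have h1 : T.dir a (fun y => T.dir b (T.dir c F) y - T.dir c (T.dir b F) y) x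
      = T.dir a (fun y => ∑ e, T.struc b c e y * T.dir e F y) x :=
    dir_congr (fun y hy => dir_dir_sub b c hF hy) a hx
  rw [dir_sub a ((hF.dir c).dir b) ((hF.dir b).dir c) hx,
    dir_sum a (fun e _ => (smooth_struc b c e).mul (hF.dir e)) hx] at h1
  have h2 : ∀ e, T.dir a (T.dir e F) x = T.dir e (T.dir a F) x
      + ∑ d, T.struc a e d x * T.dir d F x := fun e => by
    rw [← dir_dir_sub a e hF hx]; ring
  rw [h1, dir_dir_sub b c (hF.dir a) hx]
  simp only [dir_mul a (smooth_struc b c _) (hF.dir _) hx, h2, add_mul, mul_add,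
    Finset.sum_add_distrib, Finset.sum_mul, Finset.mul_sum]
  rw [Finset.sum_comm (s := Finset.univ) (t := Finset.univ)
    (f := fun d e => T.struc b c e x * T.struc a e d x * T.dir d F x)]
  simp only [mul_assoc]
  ring

/-- The Jacobi identity in the tetrad. -/
theorem jacobi (a b c d : Idx) {x : M} (hx : x ∈ T.domain) :
    (T.dir a (T.struc b c d) x + ∑ e, T.struc b c e x * T.struc a e d x)
    + (T.dir b (T.struc c a d) x + ∑ e, T.struc c a e x * T.struc b e d x)
    + (T.dir c (T.struc a b d) x + ∑ e, T.struc a b e x * T.struc c e d x) = 0 := by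
  refine eq_zero_of_sum_dir_eq_zero hx (fun d =>
    (T.dir a (T.struc b c d) x + ∑ e, T.struc b c e x * T.struc a e d x)
    + (T.dir b (T.struc c a d) x + ∑ e, T.struc c a e x * T.struc b e d x)
    + (T.dir c (T.struc a b d) x + ∑ e, T.struc a b e x * T.struc c e d x)) ?_ d
  intro F hF
  -- The test function is smooth only near `x`, while the commutator identities want smoothness on
  -- the whole domain; the tetrad is therefore shrunk. Over the cyclic sum the third derivatives
  -- then cancel.
  obtain ⟨U, hUF, hU, hxU⟩ := eventually_nhds_iff.1 hF
  have hF' : (T.restrict U hU).Smooth F := fun y hy => hUF y hy.2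
  have hx' : x ∈ (T.restrict U hU).domain := ⟨hx, hxU⟩
  have h1 := dir_dir_dir_sub a b c hF' hx'
  have h2 := dir_dir_dir_sub b c a hF' hx'
  have h3 := dir_dir_dir_sub c a b hF' hx'
  have hd : (T.restrict U hU).dir = T.dir := rfl
  have hs : (T.restrict U hU).struc = T.struc := rfl
  rw [hd, hs] at h1 h2 h3
  simp only [add_mul _ _ (T.dir _ F x), Finset.sum_add_distrib] at h1 h2 h3 ⊢
  linear_combination (exp := 1) -h1 - h2 - h3

end Frame
end NullTetrad

/-! ### Symmetries of the curvature tensor. -/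

namespace NullTetrad

section Components

variable {M : Type*} [TopologicalSpace M] [ChartedSpace E4 M] [IsManifold (𝓡 4) ∞ M]
  {H : AlmostHermitian M} {T : NullTetrad H}

theorem Gam_L (a b : Idx) : T.Gam a b (0, 0) = T.conn a b (1, 1) := by
  ext x; simp [Gam, Fintype.sum_prod_type, eta, eps]

theorem Gam_N (a b : Idx) : T.Gam a b (1, 1) = T.conn a b (0, 0) := by
  ext x; simp [Gam, Fintype.sum_prod_type, eta, eps]

theorem Gam_M (a b : Idx) : T.Gam a b (0, 1) = fun x => -T.conn a b (1, 0) x := by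
  ext x; simp [Gam, Fintype.sum_prod_type, eta, eps]

theorem Gam_Mt (a b : Idx) : T.Gam a b (1, 0) = fun x => -T.conn a b (0, 1) x := by
  ext x; simp [Gam, Fintype.sum_prod_type, eta, eps]

theorem conn_self (a b : Idx) {x : M} (hx : x ∈ T.domain) : T.conn a b b x = 0 :=
  self_eq_neg.1 (conn_antisymm a b b hx)

theorem dir_conn_antisymm (a b c d : Idx) {x : M} (hx : x ∈ T.domain) :
    T.dir a (T.conn b d c) x = -T.dir a (T.conn b c d) x := by
  rw [dir_congr (fun y hy => conn_antisymm b c d hy) a hx, dir_neg a (smooth_conn b c d) hx]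

/-! ### The curvature tensor -/

theorem riemUp_antisymm (a b c d : Idx) (x : M) : T.riemUp b a c d x = -T.riemUp a b c d x := by
  simp only [riemUp, neg_add, ← Finset.sum_neg_distrib]
  congr 1
  · ring
  · exact Finset.sum_congr rfl fun e _ => by ring

theorem riem_antisymm_left (a b c d : Idx) (x : M) : T.riem b a c d x = -T.riem a b c d x := by
  simp only [riem, riemUp_antisymm a b, neg_mul, Finset.sum_neg_distrib]

theorem sum_Gam_mul_eta (a b d : Idx) (x : M) : ∑ e, T.Gam a b e x * eta e d = T.conn a b d x := by
  simp only [Gam, Finset.sum_mul]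
  rw [Finset.sum_comm]
  simp only [mul_assoc, ← Finset.mul_sum, eta_inv]
  simp

theorem riem_eq (a b c d : Idx) {x : M} (hx : x ∈ T.domain) :
    T.riem a b c d x = T.dir a (T.conn b c d) x - T.dir b (T.conn a c d) x
      + ∑ e, (T.Gam b c e x * T.conn a e d x - T.Gam a c e x * T.conn b e d x
        - T.struc a b e x * T.conn e c d x) := by
  have h : ∀ a b, T.dir a (T.conn b c d) x = ∑ e, T.dir a (T.Gam b c e) x * eta e d := by
    intro a b
    have h1 : T.conn b c d = fun y => ∑ e, T.Gam b c e y * eta e d :=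
      funext fun y => (sum_Gam_mul_eta b c d y).symm
    rw [h1, dir_sum a (fun e _ => (smooth_Gam b c e).mul (smooth_const _)) hx]
    refine Finset.sum_congr rfl fun e _ => ?_
    rw [dir_mul a (smooth_Gam b c e) (smooth_const _) hx, dir_const]
    ring
  simp only [riem, riemUp, add_mul, sub_mul, Finset.sum_add_distrib, Finset.sum_sub_distrib,
    ← h, Finset.sum_mul, struc]
  simp only [← sum_Gam_mul_eta _ _ d x, Finset.mul_sum]
  rw [Finset.sum_comm (f := fun x_1 i => T.Gam b c i x * T.Gam a i x_1 x * eta x_1 d),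
    Finset.sum_comm (f := fun x_1 i => T.Gam a c i x * T.Gam b i x_1 x * eta x_1 d),
    Finset.sum_comm (f := fun x_1 i => T.Gam a b i x * T.Gam i c x_1 x * eta x_1 d),
    Finset.sum_comm (f := fun x_1 i => T.Gam b a i x * T.Gam i c x_1 x * eta x_1 d)]
  simp only [mul_assoc]

/-- A consequence of metric compatibility: with `conn` skew in its last two indices, the derivative
and torsion terms change sign and the two quadratic terms are exchanged. -/
theorem riem_antisymm_right (a b c d : Idx) {x : M} (hx : x ∈ T.domain) :
    T.riem a b d c x = -T.riem a b c d x := by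
  rw [riem_eq a b d c hx, riem_eq a b c d hx, dir_conn_antisymm a b c d hx,
    dir_conn_antisymm b a c d hx]
  have hc : ∀ a b c, T.conn a c b x = -T.conn a b c x := fun a b c => conn_antisymm a b c hx
  simp only [Fintype.sum_prod_type, Fin.sum_univ_two, Gam_L, Gam_M, Gam_Mt, Gam_N]
  rw [hc (0, 0) c d, hc (0, 1) c d, hc (1, 0) c d, hc (1, 1) c d]
  rw [hc a c (0, 0), hc a c (0, 1), hc a c (1, 0), hc a c (1, 1), hc b c (0, 0), hc b c (0, 1),
    hc b c (1, 0), hc b c (1, 1), hc a (0, 0) d, hc a (0, 1) d, hc a (1, 0) d, hc a (1, 1) d,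
    hc b (0, 0) d, hc b (0, 1) d, hc b (1, 0) d, hc b (1, 1) d]
  ring

/-- The structure functions are the antisymmetrized connection coefficients, and with them the
cyclic sum becomes the Jacobi identity term by term. -/
theorem riemUp_bianchi (a b c d : Idx) {x : M} (hx : x ∈ T.domain) :
    T.riemUp a b c d x + T.riemUp b c a d x + T.riemUp c a b d x = 0 := by
  have h := jacobi a b c d hx
  simp only [riemUp]
  unfold struc at h
  rw [dir_sub a (smooth_Gam b c d) (smooth_Gam c b d) hx,
    dir_sub b (smooth_Gam c a d) (smooth_Gam a c d) hx,
    dir_sub c (smooth_Gam a b d) (smooth_Gam b a d) hx] at h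
  rw [← h]
  simp only [sub_mul, mul_sub, Finset.sum_sub_distrib]
  ring

theorem riem_bianchi (a b c d : Idx) {x : M} (hx : x ∈ T.domain) :
    T.riem a b c d x + T.riem b c a d x + T.riem c a b d x = 0 := by
  simp only [riem, ← Finset.sum_add_distrib, ← add_mul, riemUp_bianchi a b c _ hx, zero_mul,
    Finset.sum_const_zero]

/-- The classical octahedron argument: four first Bianchi identities combined using the two
antisymmetries. -/
theorem riem_pair_symm (a b c d : Idx) {x : M} (hx : x ∈ T.domain) :
    T.riem c d a b x = T.riem a b c d x := by
  have l : ∀ a b c d, T.riem b a c d x = -T.riem a b c d x :=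
    fun a b c d => riem_antisymm_left a b c d x
  have r : ∀ a b c d, T.riem a b d c x = -T.riem a b c d x :=
    fun a b c d => riem_antisymm_right a b c d hx
  have h1 := riem_bianchi a b c d hx
  have h2 := riem_bianchi b c d a hx
  have h3 := riem_bianchi c d a b hx
  have h4 := riem_bianchi d a b c hx
  rw [l a c] at h1
  rw [r b c a d, r c d a b, l b d, r b d a c] at h2
  rw [l a d, r a d b c, r a c b d] at h3
  rw [l a d, r a b c d] at h4
  linear_combination (-1 / 2) * (h1 + h2 - h3 - h4)

/-- The components of the Ricci tensor. -/
theorem ricci_eq (a b : Idx) (x : M) :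
    T.ricci a b x = T.riem a (0, 0) b (1, 1) x + T.riem a (1, 1) b (0, 0) x
      - T.riem a (0, 1) b (1, 0) x - T.riem a (1, 0) b (0, 1) x := by
  simp [ricci, riem, Fintype.sum_prod_type, eta, eps]
  ring

end Components
end NullTetrad

/-- The eigenvalues of `J` on the members of the tetrad. -/
def jEigen (b : Idx) : ℂ := if b.1 = 0 then -Complex.I else Complex.I

@[simp] theorem jEigen_zero (A' : Fin 2) : jEigen (0, A') = -Complex.I := rfl

@[simp] theorem jEigen_one (A' : Fin 2) : jEigen (1, A') = Complex.I := rfl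

/-! ### The Lee form, the weighted connection form and the curvature components that enter. -/

namespace NullTetrad

section NewmanPenrose

variable {M : Type*} [TopologicalSpace M] [ChartedSpace E4 M] [IsManifold (𝓡 4) ∞ M]
  {H : AlmostHermitian M} {T : NullTetrad H}

theorem cinner_capply_right (V : CField M) (b : Idx) {x : M} (hx : x ∈ T.domain) :
    cinner H.g V (capply H.J (T.Z b)) x = jEigen b * cinner H.g V (T.Z b) x := by
  obtain ⟨b, B'⟩ := b
  fin_cases b
  · have h := T.eigen_minus B' x hx
    have h1 : (capply H.J (T.Z (0, B'))).re x = (T.Z (0, B')).im x := congrArg Prod.fst h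
    have h2 : (capply H.J (T.Z (0, B'))).im x = -(T.Z (0, B')).re x := congrArg Prod.snd h
    simp only [Fin.zero_eta, jEigen_zero, cinner, h1, h2, map_neg]
    apply Complex.ext <;> simp
    ring
  · have h := T.eigen_plus B' x hx
    have h1 : (capply H.J (T.Z (1, B'))).re x = -(T.Z (1, B')).im x := congrArg Prod.fst h
    have h2 : (capply H.J (T.Z (1, B'))).im x = (T.Z (1, B')).re x := congrArg Prod.snd h
    simp only [Fin.mk_one, jEigen_one, cinner, h1, h2, map_neg]
    apply Complex.ext <;> simp <;> ring

theorem Jc_eq (c b : Idx) {x : M} (hx : x ∈ T.domain) :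
    T.Jc c b x = if c = b then jEigen b else 0 := by
  have h : T.Jc c b x = jEigen b * ∑ d, eta c d * eta d b := by
    simp only [Jc, cinner_capply_right _ b hx, T.normalized _ b x hx, Finset.mul_sum]
    exact Finset.sum_congr rfl fun d _ => by ring
  rw [h, eta_inv]
  split_ifs <;> simp

/-- `J` has constant diagonal components, so ∇J is the commutator of the connection matrix with a
diagonal matrix and sees only the mixing of the two eigenbundles. -/
theorem nablaJ_eq (b c a : Idx) {x : M} (hx : x ∈ T.domain) :
    T.nablaJ b c a x = T.Gam b a c x * (jEigen a - jEigen c) := by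
  rw [nablaJ, dir_congr (fun y hy => Jc_eq c a hy) b hx, dir_const]
  simp [Jc_eq _ _ hx]
  ring

theorem lee_eq (a : Idx) {x : M} (hx : x ∈ T.domain) :
    T.lee a x = -(1 / 2) * ∑ b, jEigen b * (T.Gam b a b x * (jEigen a - jEigen b)) := by
  simp only [lee, nablaJ_eq _ _ _ hx, Jc_eq _ _ hx]
  simp

/-- The right-hand side is ρ; the three companion lemmas below give τ, τ' and ρ' as the components
along m, m̃ and n. -/
theorem lee_L {x : M} (hx : x ∈ T.domain) : T.lee (0, 0) x = T.conn (1, 0) (0, 0) (0, 1) x := by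
  rw [lee_eq _ hx]
  simp [Fintype.sum_prod_type, Gam_M, Gam_Mt, Gam_N, Gam_L, conn_self _ _ hx]
  linear_combination (-1 : ℂ) * T.conn (1, 0) (0, 0) (0, 1) x * Complex.I_sq

theorem lee_M {x : M} (hx : x ∈ T.domain) : T.lee (0, 1) x = T.conn (1, 1) (0, 0) (0, 1) x := by
  rw [lee_eq _ hx]
  simp [Fintype.sum_prod_type, Gam_M, Gam_Mt, Gam_N, Gam_L, conn_self _ _ hx]
  rw [conn_antisymm (1, 1) (0, 0) (0, 1) hx]
  linear_combination (-1 : ℂ) * T.conn (1, 1) (0, 0) (0, 1) x * Complex.I_sq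

theorem lee_Mt {x : M} (hx : x ∈ T.domain) :
    T.lee (1, 0) x = -T.conn (0, 0) (1, 0) (1, 1) x := by
  rw [lee_eq _ hx]
  simp [Fintype.sum_prod_type, Gam_M, Gam_Mt, Gam_N, Gam_L, conn_self _ _ hx]
  linear_combination T.conn (0, 0) (1, 0) (1, 1) x * Complex.I_sq

theorem lee_N {x : M} (hx : x ∈ T.domain) : T.lee (1, 1) x = -T.conn (0, 1) (1, 0) (1, 1) x := by
  rw [lee_eq _ hx]
  simp [Fintype.sum_prod_type, Gam_M, Gam_Mt, Gam_N, Gam_L, conn_self _ _ hx]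
  rw [conn_antisymm (0, 1) (1, 0) (1, 1) hx]
  linear_combination (-1 : ℂ) * T.conn (0, 1) (1, 0) (1, 1) x * Complex.I_sq

theorem omega_eq (a : Idx) (x : M) :
    T.omega a x = -(1 / 2) * (T.conn a (0, 0) (1, 1) x - T.conn a (0, 1) (1, 0) x) := by
  simp [omega, spin, eps, Gam_L, Gam_M]
  ring

theorem P_eq (a : Idx) {x : M} (hx : x ∈ T.domain) :
    T.P a x = T.omega a x - (1 / 2) * Complex.I * (jEigen a * T.lee a x) := by
  simp [P, Jc_eq _ _ hx]

/-- On the -i eigenbundle the term -(i/2) J f of P is -f/2, which shifts the conformal weight to w -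
p/2; on the +i eigenbundle the shift is to w + p/2. -/
theorem wform_minus (w : ℝ) (p : ℤ) (A' : Fin 2) {x : M} (hx : x ∈ T.domain) :
    T.wform w p (0, A') x = ((w : ℂ) - p / 2) * T.lee (0, A') x
      - p / 2 * (T.conn (0, A') (0, 0) (1, 1) x - T.conn (0, A') (0, 1) (1, 0) x) := by
  rw [wform, P_eq _ hx, omega_eq, jEigen_zero]
  linear_combination (1 / 2) * (p : ℂ) * T.lee (0, A') x * Complex.I_sq

theorem wform_plus (w : ℝ) (p : ℤ) (A' : Fin 2) {x : M} (hx : x ∈ T.domain) :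
    T.wform w p (1, A') x = ((w : ℂ) + p / 2) * T.lee (1, A') x
      - p / 2 * (T.conn (1, A') (0, 0) (1, 1) x - T.conn (1, A') (0, 1) (1, 0) x) := by
  rw [wform, P_eq _ hx, omega_eq, jEigen_one]
  linear_combination -(1 / 2) * (p : ℂ) * T.lee (1, A') x * Complex.I_sq

theorem smooth_lee (a : Idx) : T.Smooth (T.lee a) :=
  ((smooth_const (-(1 / 2))).mul (Smooth.sum (s := Finset.univ) fun b _ => (smooth_const (jEigen b)).mul
    ((smooth_Gam b a b).mul (smooth_const (jEigen a - jEigen b))))).congr fun _ hy => lee_eq a hy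

theorem smooth_wform (w : ℝ) (p : ℤ) (a : Idx) : T.Smooth (T.wform w p a) := by
  obtain ⟨a, A'⟩ := a
  fin_cases a
  · exact Smooth.congr (((smooth_const ((w : ℂ) - p / 2)).mul (smooth_lee (0, A'))).sub
      ((smooth_const ((p : ℂ) / 2)).mul ((smooth_conn (0, A') (0, 0) (1, 1)).sub
        (smooth_conn (0, A') (0, 1) (1, 0))))) fun x hx => wform_minus w p A' hx
  · exact Smooth.congr (((smooth_const ((w : ℂ) + p / 2)).mul (smooth_lee (1, A'))).sub
      ((smooth_const ((p : ℂ) / 2)).mul ((smooth_conn (1, A') (0, 0) (1, 1)).sub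
        (smooth_conn (1, A') (0, 1) (1, 0))))) fun x hx => wform_plus w p A' hx

theorem dir_wform_minus (w : ℝ) (p : ℤ) (a : Idx) (A' : Fin 2) {x : M} (hx : x ∈ T.domain) :
    T.dir a (T.wform w p (0, A')) x = ((w : ℂ) - p / 2) * T.dir a (T.lee (0, A')) x
      - p / 2 * (T.dir a (T.conn (0, A') (0, 0) (1, 1)) x
        - T.dir a (T.conn (0, A') (0, 1) (1, 0)) x) := by
  have hs := (smooth_conn (T := T) (0, A') (0, 0) (1, 1)).sub (smooth_conn (0, A') (0, 1) (1, 0))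
  rw [dir_congr (fun y hy => wform_minus w p A' hy) a hx,
    dir_sub a ((smooth_const _).mul (smooth_lee _)) ((smooth_const _).mul hs) hx,
    dir_const_mul a _ (smooth_lee _) hx, dir_const_mul a _ hs hx,
    dir_sub a (smooth_conn _ _ _) (smooth_conn _ _ _) hx]

theorem dir_wform_plus (w : ℝ) (p : ℤ) (a : Idx) (A' : Fin 2) {x : M} (hx : x ∈ T.domain) :
    T.dir a (T.wform w p (1, A')) x = ((w : ℂ) + p / 2) * T.dir a (T.lee (1, A')) x
      - p / 2 * (T.dir a (T.conn (1, A') (0, 0) (1, 1)) x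
        - T.dir a (T.conn (1, A') (0, 1) (1, 0)) x) := by
  have hs := (smooth_conn (T := T) (1, A') (0, 0) (1, 1)).sub (smooth_conn (1, A') (0, 1) (1, 0))
  rw [dir_congr (fun y hy => wform_plus w p A' hy) a hx,
    dir_sub a ((smooth_const _).mul (smooth_lee _)) ((smooth_const _).mul hs) hx,
    dir_const_mul a _ (smooth_lee _) hx, dir_const_mul a _ hs hx,
    dir_sub a (smooth_conn _ _ _) (smooth_conn _ _ _) hx]

theorem dir_lee_L (a : Idx) {x : M} (hx : x ∈ T.domain) :
    T.dir a (T.lee (0, 0)) x = T.dir a (T.conn (1, 0) (0, 0) (0, 1)) x :=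
  dir_congr (fun _ hy => lee_L hy) a hx

theorem dir_lee_M (a : Idx) {x : M} (hx : x ∈ T.domain) :
    T.dir a (T.lee (0, 1)) x = T.dir a (T.conn (1, 1) (0, 0) (0, 1)) x :=
  dir_congr (fun _ hy => lee_M hy) a hx

theorem dir_lee_Mt (a : Idx) {x : M} (hx : x ∈ T.domain) :
    T.dir a (T.lee (1, 0)) x = -T.dir a (T.conn (0, 0) (1, 0) (1, 1)) x :=
  (dir_congr (fun _ hy => lee_Mt hy) a hx).trans (dir_neg a (smooth_conn _ _ _) hx)

theorem dir_lee_N (a : Idx) {x : M} (hx : x ∈ T.domain) :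
    T.dir a (T.lee (1, 1)) x = -T.dir a (T.conn (0, 1) (1, 0) (1, 1)) x :=
  (dir_congr (fun _ hy => lee_N hy) a hx).trans (dir_neg a (smooth_conn _ _ _) hx)

/-! ### Curvature components -/

theorem riem_self_left (a c d : Idx) (x : M) : T.riem a a c d x = 0 :=
  self_eq_neg.1 (riem_antisymm_left a a c d x)

theorem scal_eq {x : M} (hx : x ∈ T.domain) :
    T.scal x = 2 * T.riem (1, 1) (0, 0) (0, 0) (1, 1) x + 2 * T.riem (0, 1) (1, 0) (1, 0) (0, 1) x
      - 4 * T.riem (0, 0) (0, 1) (1, 1) (1, 0) x - 4 * T.riem (0, 0) (1, 0) (1, 1) (0, 1) x := by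
  have l : ∀ a b c d, T.riem b a c d x = -T.riem a b c d x :=
    fun a b c d => riem_antisymm_left a b c d x
  have r : ∀ a b c d, T.riem a b d c x = -T.riem a b c d x :=
    fun a b c d => riem_antisymm_right a b c d hx
  have s : ∀ a b c d, T.riem c d a b x = T.riem a b c d x :=
    fun a b c d => riem_pair_symm a b c d hx
  have h : T.scal x = T.ricci (0, 0) (1, 1) x + T.ricci (1, 1) (0, 0) x - T.ricci (0, 1) (1, 0) x
      - T.ricci (1, 0) (0, 1) x := by
    simp [scal, Fintype.sum_prod_type, eta, eps]; ring
  simp only [h, ricci_eq, riem_self_left]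
  linear_combination (l (1, 1) (0, 0) (1, 1) (0, 0)) - r (1, 1) (0, 0) (0, 0) (1, 1)
    - (s (0, 0) (1, 0) (1, 1) (0, 1)) - (s (0, 0) (0, 1) (1, 1) (1, 0))
    - ((l (0, 0) (0, 1) (1, 0) (1, 1)) - r (0, 0) (0, 1) (1, 1) (1, 0))
    - ((l (1, 1) (0, 1) (1, 0) (0, 0)) - r (1, 1) (0, 1) (0, 0) (1, 0) + (s (0, 0) (1, 0) (1, 1) (0, 1)))
    - ((l (0, 0) (1, 0) (0, 1) (1, 1)) - r (0, 0) (1, 0) (1, 1) (0, 1))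
    - ((l (1, 1) (1, 0) (0, 1) (0, 0)) - r (1, 1) (1, 0) (0, 0) (0, 1) + (s (0, 0) (0, 1) (1, 1) (1, 0)))
    + ((l (0, 1) (1, 0) (0, 1) (1, 0)) - r (0, 1) (1, 0) (1, 0) (0, 1))

theorem ricci_symm (a b : Idx) {x : M} (hx : x ∈ T.domain) : T.ricci b a x = T.ricci a b x := by
  have s : ∀ a b c d, T.riem c d a b x = T.riem a b c d x :=
    fun a b c d => riem_pair_symm a b c d hx
  rw [ricci_eq, ricci_eq]
  linear_combination s a (1, 1) b (0, 0) + s a (0, 0) b (1, 1) - s a (1, 0) b (0, 1)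
    - s a (0, 1) b (1, 0)

/-- In the Weyl decomposition of this component the Ricci tensor enters only through R_{ℓn} -
R_{mm̃}, which is half the scalar curvature. Its leading part is Dρ' - δτ', a derivative of the Lee
form; the component in `riem_NMtLM` has leading part D'ρ - δ'τ. -/
theorem riem_LMNMt {x : M} (hx : x ∈ T.domain) :
    T.riem (0, 0) (0, 1) (1, 1) (1, 0) x = -T.Psi2 x - T.scal x / 12 := by
  have h : T.scal x = T.ricci (0, 0) (1, 1) x + T.ricci (1, 1) (0, 0) x - T.ricci (0, 1) (1, 0) x
      - T.ricci (1, 0) (0, 1) x := by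
    simp [scal, Fintype.sum_prod_type, eta, eps]; ring
  rw [ricci_symm (0, 0) (1, 1) hx, ricci_symm (0, 1) (1, 0) hx] at h
  have hP : T.Psi2 x = T.riem (0, 0) (0, 1) (1, 0) (1, 1) x
      - (1 / 2) * (T.ricci (0, 0) (1, 1) x - T.ricci (0, 1) (1, 0) x) + T.scal x / 6 := by
    simp [Psi2, weyl, eta, eps]; ring
  linear_combination hP + riem_antisymm_right (0, 0) (0, 1) (1, 1) (1, 0) hx + h / 4

theorem riem_NMtLM {x : M} (hx : x ∈ T.domain) :
    T.riem (1, 1) (1, 0) (0, 0) (0, 1) x = -T.Psi2 x - T.scal x / 12 := by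
  rw [riem_pair_symm (0, 0) (0, 1) (1, 1) (1, 0) hx, riem_LMNMt hx]

/-- The left side pairs the curvature on both sides with the bivector n∧ℓ + m∧m̃, so its derivative
part is that of the spin connection form ω. The Bianchi identity and the formula for R express it
through Ψ₂ and R alone. -/
theorem riem_anti_self_dual_trace {x : M} (hx : x ∈ T.domain) :
    T.riem (1, 1) (0, 0) (0, 0) (1, 1) x + T.riem (1, 1) (0, 0) (1, 0) (0, 1) x
      + T.riem (0, 1) (1, 0) (0, 0) (1, 1) x + T.riem (0, 1) (1, 0) (1, 0) (0, 1) x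
      = T.scal x / 6 - 4 * T.Psi2 x := by
  have h1 := riem_bianchi (1, 1) (0, 0) (1, 0) (0, 1) hx
  rw [riem_antisymm_left (1, 1) (1, 0), riem_NMtLM hx] at h1
  have h2 := riem_pair_symm (0, 0) (1, 1) (0, 1) (1, 0) hx
  rw [riem_antisymm_left (1, 1) (0, 0), riem_antisymm_right _ _ (1, 0) (0, 1) hx] at h2
  have h3 := scal_eq hx
  rw [riem_LMNMt hx] at h3
  linear_combination 2 * h1 + h2 - h3 / 2

/-- Normal form of the connection coefficients with respect to their antisymmetry. -/
theorem conn_normal_form {x : M} (hx : x ∈ T.domain) :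
    (∀ a b, T.conn a b b x = 0) ∧
    (∀ a, T.conn a (0, 1) (0, 0) x = -T.conn a (0, 0) (0, 1) x) ∧
    (∀ a, T.conn a (1, 0) (0, 0) x = -T.conn a (0, 0) (1, 0) x) ∧
    (∀ a, T.conn a (1, 1) (0, 0) x = -T.conn a (0, 0) (1, 1) x) ∧
    (∀ a, T.conn a (1, 0) (0, 1) x = -T.conn a (0, 1) (1, 0) x) ∧
    (∀ a, T.conn a (1, 1) (0, 1) x = -T.conn a (0, 1) (1, 1) x) ∧
    (∀ a, T.conn a (1, 1) (1, 0) x = -T.conn a (1, 0) (1, 1) x) :=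
  ⟨fun a b => conn_self a b hx, fun a => conn_antisymm a _ _ hx, fun a => conn_antisymm a _ _ hx,
    fun a => conn_antisymm a _ _ hx, fun a => conn_antisymm a _ _ hx,
    fun a => conn_antisymm a _ _ hx, fun a => conn_antisymm a _ _ hx⟩

end NewmanPenrose
end NullTetrad

/-! ### The operator □^𝒞, its Newman–Penrose form and the spinor factorization. -/

namespace NullTetrad

section Box

variable {M : Type*} [TopologicalSpace M] [ChartedSpace E4 M] [IsManifold (𝓡 4) ∞ M]
  {H : AlmostHermitian M} {T : NullTetrad H}

theorem dir_CScalar (w : ℝ) (p : ℤ) (a b : Idx) {F : M → ℂ} (hF : T.Smooth F) {x : M}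
    (hx : x ∈ T.domain) :
    T.dir a (T.CScalar w p b F) x = T.dir a (T.dir b F) x + T.dir a (T.wform w p b) x * F x
      + T.wform w p b x * T.dir a F x := by
  have h : T.CScalar w p b F = fun y => T.dir b F y + T.wform w p b y * F y := rfl
  rw [h, dir_add a (hF.dir b) ((smooth_wform w p b).mul hF) hx,
    dir_mul a (smooth_wform w p b) hF hx]
  ring

/-- The trace of the connection on covectors. -/
theorem boxC_eq (w : ℝ) (p : ℤ) (F : M → ℂ) (x : M) :
    T.boxC w p F x =
      T.dir (0, 0) (T.CScalar w p (1, 1) F) x + T.dir (1, 1) (T.CScalar w p (0, 0) F) x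
      - T.dir (0, 1) (T.CScalar w p (1, 0) F) x - T.dir (1, 0) (T.CScalar w p (0, 1) F) x
      - ∑ c, (T.Gam (0, 0) (1, 1) c x + T.Gam (1, 1) (0, 0) c x - T.Gam (0, 1) (1, 0) c x
        - T.Gam (1, 0) (0, 1) c x) * T.CScalar w p c F x
      + (T.wform w p (0, 0) x + 2 * T.lee (0, 0) x) * T.CScalar w p (1, 1) F x
      + (T.wform w p (1, 1) x + 2 * T.lee (1, 1) x) * T.CScalar w p (0, 0) F x
      - (T.wform w p (0, 1) x + 2 * T.lee (0, 1) x) * T.CScalar w p (1, 0) F x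
      - (T.wform w p (1, 0) x + 2 * T.lee (1, 0) x) * T.CScalar w p (0, 1) F x := by
  simp [boxC, CCovector, nablaCov, Fintype.sum_prod_type, eta, eps]
  ring

theorem boxC_eq_npExpr (w : ℝ) (p : ℤ) {F : M → ℂ} (hF : T.Smooth F) {x : M}
    (hx : x ∈ T.domain) : (1 / 2 : ℂ) * T.boxC w p F x = T.npExpr w p F x := by
  obtain ⟨c0, c1, c2, c3, c4, c5, c6⟩ := conn_normal_form hx
  -- The two inner brackets of the Newman–Penrose expression are 𝒞 along n and along m̃, since ρ'
  -- and τ' are components of the Lee form.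
  have hG : ∀ y ∈ T.domain, T.DP F y + ((p : ℂ) * T.epsilonP y + ((w : ℂ) + (p : ℂ) / 2) * T.rhoP y)
      * F y = T.CScalar w p (1, 1) F y := by
    intro y hy
    rw [CScalar, wform_plus w p 1 hy, lee_N hy]
    simp only [DP, epsilonP, rhoP, rot, conn_antisymm _ (1, 0) (1, 1) hy,
      conn_antisymm _ (0, 0) (1, 1) hy]
    ring
  have hK : ∀ y ∈ T.domain, T.delP F y + ((p : ℂ) * T.betaP y + ((w : ℂ) + (p : ℂ) / 2) * T.tauP y)
      * F y = T.CScalar w p (1, 0) F y := by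
    intro y hy
    rw [CScalar, wform_plus w p 0 hy, lee_Mt hy]
    simp only [delP, betaP, tauP, rot, conn_antisymm _ (1, 0) (1, 1) hy,
      conn_antisymm _ (0, 0) (1, 1) hy]
    ring
  have e1 := riem_NMtLM hx
  have e2 := riem_LMNMt hx
  have e3 := riem_anti_self_dual_trace hx
  have k1 := dir_dir_sub (1, 1) (0, 0) hF hx
  have k2 := dir_dir_sub (1, 0) (0, 1) hF hx
  simp only [npExpr, D, del]
  rw [dir_congr hG _ hx, dir_congr hK _ hx, hG x hx, hK x hx, boxC_eq]
  simp only [dir_CScalar w p _ _ hF hx, dir_wform_minus w p _ _ hx, dir_wform_plus w p _ _ hx,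
    dir_lee_L _ hx, dir_lee_M _ hx, dir_lee_Mt _ hx, dir_lee_N _ hx]
  simp only [riem_eq _ _ _ _ hx, Fintype.sum_prod_type, Fin.sum_univ_two, Gam_L, Gam_M, Gam_Mt,
    Gam_N, struc, CScalar, wform_minus w p _ hx, wform_plus w p _ hx, lee_L hx, lee_M hx,
    lee_Mt hx, lee_N hx,
    epsilon, epsilonT, rho, rhoT, beta, betaPT, tau, tauPT, sigma, sigmaP, kappa, kappaP, rot,
    c0, c1, c2, c3, c4, c5, c6, dir_conn_antisymm _ _ (0, 1) (1, 0) hx,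
    dir_conn_antisymm _ _ (1, 0) (1, 1) hx] at e1 e2 e3 k1 k2 ⊢
  -- Half a commutator changes the symmetric ordering of □^𝒞 into the one-sided ordering. The right
  -- sides of `e1` and `e2` agree, so w contributes no curvature; those of `e1`, `e2`, `e3` add up
  -- to -6 Ψ₂, and the factor -p/4 turns this into the potential (3/2) p Ψ₂.
  linear_combination (1 / 2) * (k1 - k2) + F x * (1 / 2 * w * (e1 - e2) - p / 4 * (e1 + e2 + e3))

/-- Here the ordering is 𝒞_n𝒞_ℓ - 𝒞_m̃𝒞_m, opposite to the Newman–Penrose one, so the same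
half-curvature appears with the opposite sign. -/
theorem dolDolT_eq (w : ℝ) (p : ℤ) {F : M → ℂ} (hF : T.Smooth F) {x : M} (hx : x ∈ T.domain) :
    T.dolDolT w p F x = (1 / 2 : ℂ) * T.boxC w p F x
      + p * (3 / 2 * T.Psi2 x - (T.sigma x * T.sigmaP x - T.kappa x * T.kappaP x)) * F x := by
  obtain ⟨c0, c1, c2, c3, c4, c5, c6⟩ := conn_normal_form hx
  have e1 := riem_NMtLM hx
  have e2 := riem_LMNMt hx
  have e3 := riem_anti_self_dual_trace hx
  have k1 := dir_dir_sub (1, 1) (0, 0) hF hx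
  have k2 := dir_dir_sub (1, 0) (0, 1) hF hx
  have hT : ∀ A', T.dolT w p F A' = T.CScalar w p (0, A') F := fun _ => rfl
  rw [boxC_eq]
  simp only [dolDolT, dolPrimed, CPrimed, spinPrimed, hT, Fin.sum_univ_two,
    dir_CScalar w p _ _ hF hx, dir_wform_minus w p _ _ hx, dir_wform_plus w p _ _ hx,
    dir_lee_L _ hx, dir_lee_M _ hx, dir_lee_Mt _ hx, dir_lee_N _ hx]
  simp only [riem_eq _ _ _ _ hx, Fintype.sum_prod_type, Fin.sum_univ_two, Gam_L, Gam_M, Gam_Mt,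
    Gam_N, struc, CScalar, wform_minus _ _ _ hx, wform_plus _ _ _ hx, lee_L hx, lee_M hx,
    lee_Mt hx, lee_N hx, sigma, sigmaP, kappa, kappaP, rot,
    c0, c1, c2, c3, c4, c5, c6, dir_conn_antisymm _ _ (0, 1) (1, 0) hx,
    dir_conn_antisymm _ _ (1, 0) (1, 1) hx] at e1 e2 e3 k1 k2 ⊢
  simp [eps]
  linear_combination (1 / 2) * (k1 - k2) + F x * (1 / 2 * w * (e1 - e2) - p / 4 * (e1 + e2 + e3))

/-- The two orderings deviate from ½□^𝒞 by opposite amounts, so their difference is twice the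
deviation; the second-order part drops out. -/
theorem dolCommutator_eq (w : ℝ) (p : ℤ) {F : M → ℂ} (hF : T.Smooth F) {x : M}
    (hx : x ∈ T.domain) :
    T.dolCommutator w p F x
      = -2 * (p * (3 / 2 * T.Psi2 x - (T.sigma x * T.sigmaP x - T.kappa x * T.kappaP x)) * F x) := by
  obtain ⟨c0, c1, c2, c3, c4, c5, c6⟩ := conn_normal_form hx
  have e1 := riem_NMtLM hx
  have e2 := riem_LMNMt hx
  have e3 := riem_anti_self_dual_trace hx
  have k1 := dir_dir_sub (1, 1) (0, 0) hF hx
  have k2 := dir_dir_sub (1, 0) (0, 1) hF hx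
  have hT : ∀ A', T.dolT w p F A' = T.CScalar w p (0, A') F := fun _ => rfl
  have hD : ∀ A', T.dol w p F A' = T.CScalar w p (1, A') F := fun _ => rfl
  simp only [dolCommutator, dolPrimed, dolTPrimed, CPrimed, spinPrimed, hT, hD, Fin.sum_univ_two,
    dir_CScalar w p _ _ hF hx, dir_wform_minus w p _ _ hx, dir_wform_plus w p _ _ hx,
    dir_lee_L _ hx, dir_lee_M _ hx, dir_lee_Mt _ hx, dir_lee_N _ hx]
  simp only [riem_eq _ _ _ _ hx, Fintype.sum_prod_type, Fin.sum_univ_two, Gam_L, Gam_M, Gam_Mt,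
    Gam_N, struc, CScalar, wform_minus _ _ _ hx, wform_plus _ _ _ hx, lee_L hx, lee_M hx,
    lee_Mt hx, lee_N hx, sigma, sigmaP, kappa, kappaP, rot,
    c0, c1, c2, c3, c4, c5, c6, dir_conn_antisymm _ _ (0, 1) (1, 0) hx,
    dir_conn_antisymm _ _ (1, 0) (1, 1) hx] at e1 e2 e3 k1 k2 ⊢
  simp [eps]
  linear_combination (-1 : ℂ) * (k1 - k2) - F x * (w * (e1 - e2) - p / 2 * (e1 + e2 + e3))

end Box
end NullTetrad

/-! ### Consequences of integrability and of conformal self-duality. -/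

namespace NullTetrad

section Integrability

variable {M : Type*} [TopologicalSpace M] [ChartedSpace E4 M] [IsManifold (𝓡 4) ∞ M]
  {H : AlmostHermitian M} {T : NullTetrad H}

theorem J_re_minus (A' : Fin 2) {x : M} (hx : x ∈ T.domain) :
    H.J x ((T.Z (0, A')).re x) = (T.Z (0, A')).im x :=
  congrArg Prod.fst (T.eigen_minus A' x hx)

theorem J_im_minus (A' : Fin 2) {x : M} (hx : x ∈ T.domain) :
    H.J x ((T.Z (0, A')).im x) = -(T.Z (0, A')).re x :=
  congrArg Prod.snd (T.eigen_minus A' x hx)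

/-- The `-i` eigenbundle of `J` is isotropic. -/
theorem cinner_eq_zero_of_eigen_minus {V W : CField M} {x : M}
    (hV : H.J x (V.re x) = V.im x) (hW : H.J x (W.re x) = W.im x) : cinner H.g V W x = 0 := by
  have ho : ∀ v w, H.g x (H.J x v) (H.J x w) = H.g x v w := H.J_orthogonal x
  have h1 := ho (V.re x) (W.re x)
  have h2 := ho (V.re x) (W.im x)
  rw [hV, hW] at h1
  rw [← hW, H.J_sq, hV, map_neg, hW] at h2
  unfold cinner
  apply Complex.ext
  · simp [h1]
  · simp [← h2]

/-- If `J` is integrable, then the `-i` eigenbundle is involutive. -/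
theorem cinner_cbracket_eq_zero (hH : H.IsHermitian) (A' B' C' : Fin 2) {x : M}
    (hx : x ∈ T.domain) :
    cinner H.g (cbracket (T.Z (0, A')) (T.Z (0, B'))) (T.Z (0, C')) x = 0 := by
  refine cinner_eq_zero_of_eigen_minus ?_ (J_re_minus C' hx)
  have hN := hH x _ _ (T.smooth_re (0, A') x hx) (T.smooth_re (0, B') x hx)
  have hJ : ∀ A', (fun y => H.J y ((T.Z (0, A')).re y)) =ᶠ[𝓝 x] (T.Z (0, A')).im := fun A' =>
    Filter.eventuallyEq_of_mem (T.isOpen_domain.mem_nhds hx) fun y hy => J_re_minus A' hy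
  have hr : ∀ A', (T.Z (0, A')).re =ᶠ[𝓝 x] (T.Z (0, A')).re := fun _ =>
    Filter.Eventually.of_forall fun _ => rfl
  rw [(hJ A').mlieBracket_vectorField_eq (hJ B'),
    (hJ A').mlieBracket_vectorField_eq (hr B'),
    (hr A').mlieBracket_vectorField_eq (hJ B')] at hN
  -- For fields X + iJX and Y + iJY, applying `J` to the Nijenhuis identity gives exactly the
  -- statement that `J` maps the real part of their bracket to its imaginary part, so the bracket is
  -- again a -i eigenvector.
  have h2 := congrArg (H.J x) hN
  simp only [map_sub, H.J_sq, map_zero] at h2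
  change H.J x (mlieBracket (𝓡 4) (T.Z (0, A')).re (T.Z (0, B')).re x
      - mlieBracket (𝓡 4) (T.Z (0, A')).im (T.Z (0, B')).im x)
    = mlieBracket (𝓡 4) (T.Z (0, A')).re (T.Z (0, B')).im x
      + mlieBracket (𝓡 4) (T.Z (0, A')).im (T.Z (0, B')).re x
  rw [map_sub, ← sub_eq_zero, ← neg_eq_zero, ← h2]
  abel

theorem kappa_eq_zero (hH : H.IsHermitian) {x : M} (hx : x ∈ T.domain) : T.kappa x = 0 := by
  have h := koszul_sub_koszul H (T.Z (0, 0)) (T.Z (0, 1)) (T.Z (0, 0)) x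
  rw [cinner_cbracket_eq_zero hH 0 1 0 hx] at h
  have h1 := conn_antisymm (T := T) (0, 0) (0, 1) (0, 0) hx
  have h2 := conn_self (T := T) (0, 1) (0, 0) hx
  simp only [kappa, rot]
  simp only [conn] at h1 h2 ⊢
  linear_combination h1 - h - h2

theorem sigma_eq_zero (hH : H.IsHermitian) {x : M} (hx : x ∈ T.domain) : T.sigma x = 0 := by
  have h := koszul_sub_koszul H (T.Z (0, 0)) (T.Z (0, 1)) (T.Z (0, 1)) x
  rw [cinner_cbracket_eq_zero hH 0 1 1 hx] at h
  have h2 := conn_self (T := T) (0, 0) (0, 1) hx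
  simp only [sigma, rot]
  simp only [conn] at h2 ⊢
  linear_combination h2 - h

/-- These weights make w + p/2 = -1 and w - p/2 + 1 = -2s, which are the coefficients of the
Teukolsky operator. The potentials combine as -4(s - ½)(s - 1) - 6s = -2(2s² + 1). -/
theorem teukolsky_eq (hH : H.IsHermitian) (s : ℝ) (p : ℤ) (hp : (p : ℝ) = 2 * s) {χ : M → ℂ}
    (hχ : T.Smooth χ) {x : M} (hx : x ∈ T.domain) :
    T.teukolsky s χ x
      = T.boxC (-s - 1) p χ x - 2 * (2 * (s : ℂ) ^ 2 + 1) * T.Psi2 x * χ x := by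
  have hp' : (p : ℂ) = 2 * s := by exact_mod_cast congrArg (fun r : ℝ => (r : ℂ)) hp
  have h := boxC_eq_npExpr (-s - 1) p hχ hx
  have hw : ((-s - 1 : ℝ) : ℂ) + 2 * s / 2 = -1 := by push_cast; ring
  have hw' : ((-s - 1 : ℝ) : ℂ) - 2 * s / 2 + 1 = -(2 * s) := by push_cast; ring
  have hG : ∀ a b : ℂ, 2 * s * a + -1 * b = 2 * s * a - b := fun a b => by ring
  simp only [npExpr, hp', hw, hw', kappa_eq_zero hH hx, sigma_eq_zero hH hx, hG] at h
  simp only [teukolsky]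
  linear_combination -2 * h

/-- The bivector ℓ∧m is anti-self-dual, so the Hodge star changes the sign of this Weyl component,
and self-duality equates it with its negative. -/
theorem Psi2_eq_zero (hH : H.IsConformallySelfDual) {x : M} (hx : x ∈ T.domain) :
    T.Psi2 x = 0 := by
  have h := hH T x hx (0, 0) (0, 1) (1, 0) (1, 1)
  have hf : ∀ a b, T.form a b x = eta a b * jEigen b := fun a b => by simp [form, Jc_eq _ _ hx]
  have ha : T.weyl (0, 1) (0, 0) (1, 0) (1, 1) x = -T.weyl (0, 0) (0, 1) (1, 0) (1, 1) x := by
    simp only [weyl, riem_antisymm_left (0, 0) (0, 1)]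
    ring
  simp [starWeyl, vol, hf, Fintype.sum_prod_type, eta, eps, ha] at h
  simp only [Psi2]
  linear_combination -(1 / 2 : ℂ) * h

end Integrability
end NullTetrad

/-! ### Complex linearity, locality and conformal behaviour of the Koszul formula. -/

section Scaling

variable {M : Type*} [TopologicalSpace M] [ChartedSpace E4 M]

/-- Multiplication of complex vector fields by complex constants. -/
def cscale (c : ℂ) (V : CField M) : CField M := fun x =>
  (c.re • V.re x - c.im • V.im x, c.re • V.im x + c.im • V.re x)

theorem cinner_cscale_left (g : BilinField M) (c : ℂ) (V W : CField M) (x : M) :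
    cinner g (cscale c V) W x = c * cinner g V W x := by
  have h1 : (cscale c V).re x = c.re • V.re x - c.im • V.im x := rfl
  have h2 : (cscale c V).im x = c.re • V.im x + c.im • V.re x := rfl
  unfold cinner
  rw [h1, h2]
  apply Complex.ext <;> simp <;> ring

theorem cinner_cscale_right (g : BilinField M) (c : ℂ) (V W : CField M) (x : M) :
    cinner g V (cscale c W) x = c * cinner g V W x := by
  have h1 : (cscale c W).re x = c.re • W.re x - c.im • W.im x := rfl
  have h2 : (cscale c W).im x = c.re • W.im x + c.im • W.re x := rfl
  unfold cinner
  rw [h1, h2]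
  apply Complex.ext <;> simp <;> ring

theorem cdir_cscale (c : ℂ) (V : CField M) (F : M → ℂ) (x : M) :
    cdir (cscale c V) F x = c * cdir V F x := by
  have h1 : (cscale c V).re x = c.re • V.re x - c.im • V.im x := rfl
  have h2 : (cscale c V).im x = c.re • V.im x + c.im • V.re x := rfl
  unfold cdir
  rw [h1, h2]
  simp only [map_sub, map_add, map_smul, Complex.real_smul]
  conv_rhs => rw [← Complex.re_add_im c]
  linear_combination (-(c.im : ℂ) * mvfderiv (𝓡 4) F x (V.im x)) * Complex.I_sq

theorem cdir_const_mul (c : ℂ) (V : CField M) {F : M → ℂ} {x : M} (hF : SmoothFunAt F x) :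
    cdir V (fun y => c * F y) x = c * cdir V F x := by
  rw [cdir_mul V (smoothFunAt_const c x) hF, cdir_const, zero_mul, zero_add]

theorem cdir_ofReal_comp (V : CField M) {h : ℝ → ℝ} {h' : ℝ} {u : M → ℝ} {x : M}
    (hh : HasDerivAt h h' (u x)) (hu : ContMDiffAt (𝓡 4) 𝓘(ℝ, ℝ) ∞ u x) :
    cdir V (fun y => (h (u y) : ℂ)) x = h' * cdir V (fun y => (u y : ℂ)) x := by
  have key : ∀ {h : ℝ → ℝ} {h' : ℝ}, HasDerivAt h h' (u x) → ∀ v : TangentSpace (𝓡 4) x,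
      mvfderiv (𝓡 4) (fun y => (h (u y) : ℂ)) x v = h' * (mvfderiv (𝓡 4) u x v : ℝ) := by
    intro h h' hh v
    have h1 : HasMFDerivAt 𝓘(ℝ, ℝ) 𝓘(ℝ, ℂ) (fun r => (h r : ℂ)) (u x) _ :=
      hh.ofReal_comp.hasFDerivAt.hasMFDerivAt
    have h2 := h1.comp x (hu.mdifferentiableAt (by simp)).hasMFDerivAt
    have h3 : mvfderiv (𝓡 4) (fun y => (h (u y) : ℂ)) x v
      = mfderiv (𝓡 4) 𝓘(ℝ, ℂ) ((fun r => (h r : ℂ)) ∘ u) x v := rfl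
    rw [h3, h2.mfderiv]
    change (mvfderiv (𝓡 4) u x v : ℝ) • (h' : ℂ) = _
    rw [Complex.real_smul, mul_comm]
  have kid := key (hasDerivAt_id (u x))
  simp only [id, Complex.ofReal_one, one_mul] at kid
  rw [cdir, cdir, key hh, key hh, kid, kid]
  ring

theorem smoothFunAt_ofReal {u : M → ℝ} {x : M} (hu : ContMDiffAt (𝓡 4) 𝓘(ℝ, ℝ) ∞ u x) :
    SmoothFunAt (fun y => (u y : ℂ)) x :=
  Complex.ofRealCLM.contDiff.contMDiff.contMDiffAt.comp x hu

variable [IsManifold (𝓡 4) ∞ M]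

theorem SmoothFieldAt.const_smul {X : RField M} {x : M} (hX : SmoothFieldAt X x) (a : ℝ) :
    SmoothFieldAt (fun y => a • X y) x :=
  ContMDiffAt.const_smul_section hX

theorem SmoothCFieldAt.cscale {V : CField M} {x : M} (hV : SmoothCFieldAt V x) (c : ℂ) :
    SmoothCFieldAt (cscale c V) x :=
  ⟨(hV.1.const_smul c.re).sub (hV.2.const_smul c.im),
    (hV.2.const_smul c.re).add (hV.1.const_smul c.im)⟩

/-- Complex linearity of the bracket is checked on its action on the coordinate functions, which
read off its components. -/
theorem cinner_cbracket_cscale_left (g : BilinField M) (c : ℂ) {V W : CField M} {x : M}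
    (hV : SmoothCFieldAt V x) (hW : SmoothCFieldAt W x) (U : CField M) :
    cinner g (cbracket (cscale c V) W) U x = c * cinner g (cbracket V W) U x := by
  have h : ∀ i, comp (cbracket (cscale c V) W) x i = c * comp (cbracket V W) x i := by
    intro i
    have hF := NullTetrad.smoothFunAt_coordFun (mem_chart_source E4 x) i
    rw [← NullTetrad.cdir_coordFun, ← NullTetrad.cdir_coordFun, cdir_cbracket (hV.cscale c) hW hF,
      cdir_cbracket hV hW hF, cdir_cscale]
    have : cdir (cscale c V) (NullTetrad.coordFun x i)
        = fun y => c * cdir V (NullTetrad.coordFun x i) y := funext fun y => cdir_cscale c V _ y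
    rw [this, cdir_const_mul c W (hV.smoothFunAt_cdir hF)]
    ring
  simp only [cinner_eq_sum, h, Finset.mul_sum]
  exact Finset.sum_congr rfl fun i _ => Finset.sum_congr rfl fun j _ => by ring

theorem cinner_cbracket_cscale_right (g : BilinField M) (c : ℂ) {V W : CField M} {x : M}
    (hV : SmoothCFieldAt V x) (hW : SmoothCFieldAt W x) (U : CField M) :
    cinner g (cbracket V (cscale c W)) U x = c * cinner g (cbracket V W) U x := by
  rw [cinner_cbracket_swap, cinner_cbracket_cscale_left g c hW hV, cinner_cbracket_swap g W V]
  ring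

variable {H : AlmostHermitian M}

theorem koszul_cscale_middle (c : ℂ) {X Y Z : CField M} {x : M} (hX : SmoothCFieldAt X x)
    (hY : SmoothCFieldAt Y x) (hZ : SmoothCFieldAt Z x) :
    koszul H.g X (cscale c Y) Z x = c * koszul H.g X Y Z x := by
  have hl : ∀ W, cinner H.g (cscale c Y) W = fun y => c * cinner H.g Y W y :=
    fun W => funext fun y => cinner_cscale_left H.g c Y W y
  have hr : ∀ W, cinner H.g W (cscale c Y) = fun y => c * cinner H.g W Y y :=
    fun W => funext fun y => cinner_cscale_right H.g c W Y y
  simp only [koszul]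
  rw [cdir_cscale, cinner_cbracket_cscale_right H.g c hX hY, cinner_cbracket_cscale_left H.g c hY hZ,
    hl, hr, hr, cdir_const_mul c X (smoothFunAt_cinner H hY hZ),
    cdir_const_mul c Z (smoothFunAt_cinner H hX hY)]
  ring

theorem koszul_cscale_right (c : ℂ) {X Y Z : CField M} {x : M} (hX : SmoothCFieldAt X x)
    (hY : SmoothCFieldAt Y x) (hZ : SmoothCFieldAt Z x) :
    koszul H.g X Y (cscale c Z) x = c * koszul H.g X Y Z x := by
  have h1 := koszul_add_koszul H X Y (cscale c Z) x
  have h2 := koszul_add_koszul H X Y Z x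
  have hr : cinner H.g Y (cscale c Z) = fun y => c * cinner H.g Y Z y :=
    funext fun y => cinner_cscale_right H.g c Y Z y
  rw [koszul_cscale_middle c hX hZ hY, hr, cdir_const_mul c X (smoothFunAt_cinner H hY hZ)] at h1
  linear_combination h1 - c * h2

omit [IsManifold (𝓡 4) ∞ M] in
-- Only germs of `Y` and `Z` matter. This is needed because `J Z_b` is a constant multiple of `Z_b`
-- only on the domain of the tetrad.
theorem koszul_congr (g : BilinField M) (X : CField M) {Y Y' Z Z' : CField M} {x : M}
    (hY : ∀ᶠ y in 𝓝 x, Y y = Y' y) (hZ : ∀ᶠ y in 𝓝 x, Z y = Z' y) :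
    koszul g X Y Z x = koszul g X Y' Z' x := by
  have hb : ∀ {V V' W W' : CField M}, (∀ᶠ y in 𝓝 x, V y = V' y) → (∀ᶠ y in 𝓝 x, W y = W' y) →
      cbracket V W x = cbracket V' W' x := by
    intro V V' W W' hV hW
    have r : ∀ {V V' : CField M}, (∀ᶠ y in 𝓝 x, V y = V' y) → V.re =ᶠ[𝓝 x] V'.re :=
      fun h => h.mono fun y hy => congrArg Prod.fst hy
    have i : ∀ {V V' : CField M}, (∀ᶠ y in 𝓝 x, V y = V' y) → V.im =ᶠ[𝓝 x] V'.im :=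
      fun h => h.mono fun y hy => congrArg Prod.snd hy
    unfold cbracket
    rw [(r hV).mlieBracket_vectorField_eq (r hW), (i hV).mlieBracket_vectorField_eq (i hW),
      (r hV).mlieBracket_vectorField_eq (i hW), (i hV).mlieBracket_vectorField_eq (r hW)]
  have hc : ∀ {V V' W W' : CField M} {y : M}, V y = V' y → W y = W' y →
      cinner g V W y = cinner g V' W' y := by
    intro V V' W W' y hV hW
    simp only [cinner, CField.re, CField.im, hV, hW]
  have hd : ∀ {V V' : CField M} (F : M → ℂ), V x = V' x → cdir V F x = cdir V' F x := by
    intro V V' F hV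
    simp only [cdir, CField.re, CField.im, hV]
  have hX : ∀ᶠ y in 𝓝 x, X y = X y := Eventually.of_forall fun _ => rfl
  simp only [koszul]
  rw [cdir_congr X (hY.mp (hZ.mono fun y h1 h2 => hc h2 h1)), hd _ hY.self_of_nhds,
    hd _ hZ.self_of_nhds, cdir_congr Y' (hZ.mono fun y h => hc rfl h),
    cdir_congr Z' (hY.mono fun y h => hc rfl h), hc (hb hX hY) hZ.self_of_nhds,
    hc (hb hX hZ) hY.self_of_nhds, hc (hb hY hZ) rfl]

/-- The Koszul formula for a conformally related metric. -/
theorem koszul_conformal {φ : M → ℝ} {X Y Z : CField M} {x : M}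
    (hφ : ContMDiffAt (𝓡 4) 𝓘(ℝ, ℝ) ∞ φ x) (hX : SmoothCFieldAt X x)
    (hY : SmoothCFieldAt Y x) (hZ : SmoothCFieldAt Z x) :
    koszul (fun x => (φ x) ^ 2 • H.g x) X Y Z x
      = (φ x : ℂ) ^ 2 * koszul H.g X Y Z x
        + φ x * (cdir X (fun y => (φ y : ℂ)) x * cinner H.g Y Z x
          + cdir Y (fun y => (φ y : ℂ)) x * cinner H.g X Z x
          - cdir Z (fun y => (φ y : ℂ)) x * cinner H.g X Y x) := by
  have hc : ∀ V W, cinner (fun x => (φ x) ^ 2 • H.g x) V W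
      = fun y => (((φ y) ^ 2 : ℝ) : ℂ) * cinner H.g V W y := by
    intro V W
    funext y
    unfold cinner
    apply Complex.ext <;> simp [-Complex.ofReal_pow] <;> ring
  have hs : SmoothFunAt (fun y => (((φ y) ^ 2 : ℝ) : ℂ)) x := smoothFunAt_ofReal (hφ.pow 2)
  have hd : ∀ V, cdir V (fun y => (((φ y) ^ 2 : ℝ) : ℂ)) x
      = 2 * φ x * cdir V (fun y => (φ y : ℂ)) x := by
    intro V
    have := cdir_ofReal_comp V (hasDerivAt_pow 2 (φ x)) hφ
    simpa using this
  simp only [koszul, hc]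
  rw [cdir_mul X hs (smoothFunAt_cinner H hY hZ), cdir_mul Y hs (smoothFunAt_cinner H hX hZ),
    cdir_mul Z hs (smoothFunAt_cinner H hX hY), hd, hd, hd]
  push_cast
  ring

end Scaling

/-! ### The conformally Kähler case. -/

namespace NullTetrad

section ConformallyKaehler

variable {M : Type*} [TopologicalSpace M] [ChartedSpace E4 M] [IsManifold (𝓡 4) ∞ M]
  {H : AlmostHermitian M} {T : NullTetrad H}

theorem capply_eq_cscale (b : Idx) {x : M} (hx : x ∈ T.domain) :
    capply H.J (T.Z b) x = cscale (jEigen b) (T.Z b) x := by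
  obtain ⟨b, B'⟩ := b
  fin_cases b
  · simp [cscale, T.eigen_minus B' x hx]
  · simp [cscale, T.eigen_plus B' x hx]

/-- The connection coefficients of a conformally Kähler geometry that are not determined by
`f = d log φ`. -/
theorem conn_of_isKahlerPair {φ : M → ℝ} (hφ : ContMDiff (𝓡 4) 𝓘(ℝ, ℝ) ∞ φ) (hpos : ∀ x, 0 < φ x)
    (hK : IsKahlerPair (fun x => (φ x) ^ 2 • H.g x) H.J) (a b c : Idx) (hbc : b.1 = c.1) {x : M}
    (hx : x ∈ T.domain) :
    (φ x : ℂ) * T.conn a b c x + (T.dir a (fun y => (φ y : ℂ)) x * eta b c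
      + T.dir b (fun y => (φ y : ℂ)) x * eta a c - T.dir c (fun y => (φ y : ℂ)) x * eta a b) = 0 := by
  have hs : ∀ a, SmoothCFieldAt (T.Z a) x := fun a => smoothCFieldAt a hx
  have hJ : ∀ b, ∀ᶠ y in 𝓝 x, capply H.J (T.Z b) y = cscale (jEigen b) (T.Z b) y := fun b =>
    Filter.mem_of_superset (T.isOpen_domain.mem_nhds hx) fun y hy => capply_eq_cscale b hy
  have hr : ∀ b, ∀ᶠ y in 𝓝 x, T.Z b y = T.Z b y := fun b => Eventually.of_forall fun _ => rfl
  have h := hK x (T.Z a) (T.Z b) (T.Z c) (hs a).1 (hs a).2 (hs b).1 (hs b).2 (hs c).1 (hs c).2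
  rw [koszul_congr _ _ (hJ b) (hr c), koszul_congr _ _ (hr b) (hJ c),
    koszul_conformal hφ.contMDiffAt (hs a) ((hs b).cscale _) (hs c),
    koszul_conformal hφ.contMDiffAt (hs a) (hs b) ((hs c).cscale _),
    koszul_cscale_middle _ (hs a) (hs b) (hs c), koszul_cscale_right _ (hs a) (hs b) (hs c)] at h
  simp only [cinner_cscale_left, cinner_cscale_right, cdir_cscale, T.normalized _ _ x hx] at h
  have hj : jEigen b = jEigen c := by simp [jEigen, hbc]
  -- For `b`, `c` in the same eigenbundle the two terms of the Kähler condition add up, with factor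
  -- 2j where j is the common eigenvalue, instead of cancelling; a further factor φ comes from the
  -- conformal change.
  have hne : (2 * φ x * jEigen c : ℂ) ≠ 0 := by
    have : (φ x : ℂ) ≠ 0 := by exact_mod_cast (hpos x).ne'
    have : jEigen c ≠ 0 := by unfold jEigen; split_ifs <;> simp
    simp [*]
  rw [hj] at h
  refine (mul_eq_zero.1 ?_).resolve_left hne
  rw [← h]
  simp only [conn, dir]
  ring

/-- That is, f = d log φ. For each direction the index triple is chosen so that exactly one
derivative of φ survives and the coefficient is the corresponding Lee component. -/
theorem lee_of_isKahlerPair {φ : M → ℝ} (hφ : ContMDiff (𝓡 4) 𝓘(ℝ, ℝ) ∞ φ)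
    (hpos : ∀ x, 0 < φ x) (hK : IsKahlerPair (fun x => (φ x) ^ 2 • H.g x) H.J) (a : Idx) {x : M}
    (hx : x ∈ T.domain) : T.dir a (fun y => (φ y : ℂ)) x = φ x * T.lee a x := by
  have h := fun a b c hbc => conn_of_isKahlerPair (T := T) hφ hpos hK a b c hbc hx
  obtain ⟨a, A'⟩ := a
  fin_cases a <;> fin_cases A'
  · have := h (1, 0) (0, 0) (0, 1) rfl
    simp [eta, eps] at this
    simp only [Fin.zero_eta, lee_L hx]
    linear_combination -this
  · have := h (1, 1) (0, 0) (0, 1) rfl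
    simp [eta, eps] at this
    simp only [Fin.zero_eta, Fin.mk_one, lee_M hx]
    linear_combination -this
  · have := h (0, 0) (1, 0) (1, 1) rfl
    simp [eta, eps] at this
    simp only [Fin.zero_eta, Fin.mk_one, lee_Mt hx]
    linear_combination this
  · have := h (0, 1) (1, 0) (1, 1) rfl
    simp [eta, eps] at this
    simp only [Fin.mk_one, lee_N hx]
    linear_combination this

theorem box_eq (F : M → ℂ) (x : M) :
    T.box F x =
      T.dir (0, 0) (T.dir (1, 1) F) x + T.dir (1, 1) (T.dir (0, 0) F) x
      - T.dir (0, 1) (T.dir (1, 0) F) x - T.dir (1, 0) (T.dir (0, 1) F) x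
      - ∑ c, (T.Gam (0, 0) (1, 1) c x + T.Gam (1, 1) (0, 0) c x - T.Gam (0, 1) (1, 0) c x
        - T.Gam (1, 0) (0, 1) c x) * T.dir c F x := by
  simp [box, nablaCov, Fintype.sum_prod_type, eta, eps]
  ring

/-- On scalars of weights `(w, 0)` of a conformally Kähler geometry, `□^𝒞` is conjugate to
`□ + 2 Ψ₂ + R / 6`. -/
theorem boxC_conformallyKaehler {φ : M → ℝ} (hφ : ContMDiff (𝓡 4) 𝓘(ℝ, ℝ) ∞ φ)
    (hpos : ∀ x, 0 < φ x) (hK : IsKahlerPair (fun x => (φ x) ^ 2 • H.g x) H.J) (w : ℝ)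
    {η : M → ℂ} (hη : T.Smooth η) {x : M} (hx : x ∈ T.domain) :
    T.boxC w 0 η x = ((φ x ^ (-(w + 1)) : ℝ) : ℂ) *
      (T.box (fun y => ((φ y ^ (w + 1) : ℝ) : ℂ) * η y) x
        + (2 * T.Psi2 x + T.scal x / 6) * (((φ x ^ (w + 1) : ℝ) : ℂ) * η x)) := by
  set Φ : M → ℂ := fun y => ((φ y ^ (w + 1) : ℝ) : ℂ) with hΦ
  have hsΦ : T.Smooth Φ := fun y _ => by
    refine smoothFunAt_ofReal ?_
    exact (Real.contDiffAt_rpow_const_of_ne (hpos y).ne').contMDiffAt.comp y hφ.contMDiffAt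
  -- Since f = d log φ, the function Φ = φ^(w+1) satisfies dΦ = (w+1) f Φ, so all derivatives of φ
  -- are eliminated in favour of f.
  have hdΦ : ∀ a, ∀ y ∈ T.domain, T.dir a Φ y = ((w : ℂ) + 1) * T.lee a y * Φ y := by
    intro a y hy
    have h := cdir_ofReal_comp (T.Z a)
      (Real.hasDerivAt_rpow_const (x := φ y) (p := w + 1) (Or.inl (hpos y).ne')) hφ.contMDiffAt
    have h2 := lee_of_isKahlerPair hφ hpos hK a hy
    have h3 : φ y ^ (w + 1) = φ y ^ (w + 1 - 1) * φ y := by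
      rw [← Real.rpow_add_one (hpos y).ne']; ring_nf
    rw [dir] at h2
    rw [dir, hΦ, h, h2]
    simp only [h3]
    push_cast
    ring
  have hd1 : ∀ b, ∀ y ∈ T.domain, T.dir b (fun y => Φ y * η y) y
      = Φ y * (T.dir b η y + ((w : ℂ) + 1) * (T.lee b y * η y)) := by
    intro b y hy
    rw [dir_mul b hsΦ hη hy, hdΦ b y hy]
    ring
  have hd2 : ∀ a b, T.dir a (fun y => T.dir b (fun y => Φ y * η y) y) x
      = Φ x * (T.dir a (T.dir b η) x
        + ((w : ℂ) + 1) * (T.dir a (T.lee b) x * η x + T.lee b x * T.dir a η x)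
        + ((w : ℂ) + 1) * T.lee a x * (T.dir b η x + ((w : ℂ) + 1) * (T.lee b x * η x))) := by
    intro a b
    have hs := (smooth_const (T := T) ((w : ℂ) + 1)).mul ((smooth_lee b).mul hη)
    rw [dir_congr (hd1 b) a hx, dir_mul a hsΦ ((hη.dir b).add hs) hx, hdΦ a x hx,
      dir_add a (hη.dir b) hs hx, dir_const_mul a _ ((smooth_lee b).mul hη) hx,
      dir_mul a (smooth_lee b) hη hx]
    ring
  have hΦ1 : ((φ x ^ (-(w + 1)) : ℝ) : ℂ) * Φ x = 1 := by
    simp only [hΦ]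
    rw [← Complex.ofReal_mul, ← Real.rpow_add (hpos x), neg_add_cancel, Real.rpow_zero,
      Complex.ofReal_one]
  generalize ((φ x ^ (-(w + 1)) : ℝ) : ℂ) = r at hΦ1 ⊢
  -- κ and σ also vanish by the Kähler condition: for these index triples every derivative of φ is
  -- multiplied by a zero metric component.
  have hκ : T.conn (0, 0) (0, 0) (0, 1) x = 0 := by
    have := conn_of_isKahlerPair (T := T) hφ hpos hK (0, 0) (0, 0) (0, 1) rfl hx
    simpa [eta, eps, (hpos x).ne'] using this
  have hσ : T.conn (0, 1) (0, 0) (0, 1) x = 0 := by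
    have := conn_of_isKahlerPair (T := T) hφ hpos hK (0, 1) (0, 0) (0, 1) rfl hx
    simpa [eta, eps, (hpos x).ne'] using this
  obtain ⟨c0, c1, c2, c3, c4, c5, c6⟩ := conn_normal_form hx
  have e1 := riem_NMtLM hx
  have e2 := riem_LMNMt hx
  have hW : ∀ a, T.wform w 0 a = fun y => (w : ℂ) * T.lee a y := by
    intro a; funext y; simp [wform]
  suffices h : T.boxC w 0 η x * Φ x = T.box (fun y => Φ y * η y) x
      + (2 * T.Psi2 x + T.scal x / 6) * (Φ x * η x) by
    linear_combination r * h - T.boxC w 0 η x * hΦ1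
  have hd2' : ∀ a b, T.dir a (T.dir b (fun y => Φ y * η y)) x = _ := hd2
  rw [boxC_eq, box_eq, hd2', hd2', hd2', hd2']
  simp only [dir_CScalar w 0 _ _ hη hx, hW, dir_const_mul _ _ (smooth_lee _) hx,
    hd1 _ x hx, Fintype.sum_prod_type, Fin.sum_univ_two]
  generalize Φ x = P
  simp only [riem_eq _ _ _ _ hx, Fintype.sum_prod_type, Fin.sum_univ_two, Gam_L, Gam_M, Gam_Mt,
    Gam_N, struc, CScalar, hW, lee_L hx, lee_M hx, lee_Mt hx, lee_N hx, dir_lee_L _ hx,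
    dir_lee_M _ hx, dir_lee_Mt _ hx, dir_lee_N _ hx,
    c0, c1, c2, c3, c4, c5, c6, hκ, hσ,
    dir_conn_antisymm _ _ (1, 0) (1, 1) hx] at e1 e2 ⊢
  -- First-order terms agree, and the zeroth-order ones differ by ∇·f + f·f; the sum of the two
  -- curvature identities says that this is -2Ψ₂ - R/6.
  linear_combination -(P * η x) * (e1 + e2)

end ConformallyKaehler
end NullTetrad

end AlmostHermitianNP

end

theorem mainTheorem9 {M : Type*} [TopologicalSpace M] [ChartedSpace AlmostHermitianNP.E4 M]
    [IsManifold (𝓡 4) ∞ M] (H : AlmostHermitianNP.AlmostHermitian M) :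
    -- the Newman–Penrose expression
    (∀ (T : AlmostHermitianNP.NullTetrad H) (w : ℝ) (p : ℤ) (ψ : M → ℂ),
      ContMDiffOn (𝓡 4) 𝓘(ℝ, ℂ) ∞ ψ T.domain →
      ∀ x ∈ T.domain, (1 / 2 : ℂ) * T.boxC w p ψ x = T.npExpr w p ψ x) ∧
    -- the Teukolsky operator
    (H.IsHermitian →
      ∀ (T : AlmostHermitianNP.NullTetrad H) (s : ℝ) (p : ℤ) (χ : M → ℂ), (p : ℝ) = 2 * s →
      ContMDiffOn (𝓡 4) 𝓘(ℝ, ℂ) ∞ χ T.domain →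
      ∀ x ∈ T.domain,
        T.teukolsky s χ x
          = T.boxC (-s - 1) p χ x - 2 * (2 * (s : ℂ) ^ 2 + 1) * T.Psi2 x * χ x) ∧
    -- the conformally Kähler case, with Kähler metric `φ² g`
    (∀ φ : M → ℝ, ContMDiff (𝓡 4) 𝓘(ℝ, ℝ) ∞ φ → (∀ x, 0 < φ x) →
      AlmostHermitianNP.IsKahlerPair (fun x => (φ x) ^ 2 • H.g x) H.J →
      ∀ (T : AlmostHermitianNP.NullTetrad H) (w : ℝ) (η : M → ℂ),
      ContMDiffOn (𝓡 4) 𝓘(ℝ, ℂ) ∞ η T.domain →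
      ∀ x ∈ T.domain,
        T.boxC w 0 η x
          = ((φ x ^ (-(w + 1)) : ℝ) : ℂ) *
            (T.box (fun y => ((φ y ^ (w + 1) : ℝ) : ℂ) * η y) x
              + (2 * T.Psi2 x + T.scal x / 6) * (((φ x ^ (w + 1) : ℝ) : ℂ) * η x))) ∧
    -- the conformally self-dual case
    (H.IsConformallySelfDual →
      ∀ (T : AlmostHermitianNP.NullTetrad H) (w : ℝ) (p : ℤ) (ψ : M → ℂ),
      (H.IsHermitian ∨ p = 0) →
      ContMDiffOn (𝓡 4) 𝓘(ℝ, ℂ) ∞ ψ T.domain →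
      ∀ x ∈ T.domain,
        T.dolDolT w p ψ x = (1 / 2 : ℂ) * T.boxC w p ψ x ∧ T.dolCommutator w p ψ x = 0) := by
  refine ⟨fun T w p ψ hψ x hx => ?_, fun hH T s p χ hp hχ x hx => ?_,
    fun φ hφ hpos hK T w η hη x hx => ?_, fun hS T w p ψ hor hψ x hx => ?_⟩
  · exact AlmostHermitianNP.NullTetrad.boxC_eq_npExpr w p
      (AlmostHermitianNP.NullTetrad.smooth_of_contMDiffOn hψ) hx
  · exact AlmostHermitianNP.NullTetrad.teukolsky_eq hH s p hp
      (AlmostHermitianNP.NullTetrad.smooth_of_contMDiffOn hχ) hx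
  · exact AlmostHermitianNP.NullTetrad.boxC_conformallyKaehler hφ hpos hK w
      (AlmostHermitianNP.NullTetrad.smooth_of_contMDiffOn hη) hx
  · have hs := AlmostHermitianNP.NullTetrad.smooth_of_contMDiffOn hψ
    -- Once Ψ₂ = 0 this is the only obstruction to both identities. It vanishes through κ = σ = 0 if
    -- `J` is integrable and through its prefactor if p = 0.
    have hp : (p : ℂ) * (T.sigma x * T.sigmaP x - T.kappa x * T.kappaP x) = 0 := by
      rcases hor with hH | rfl
      · rw [AlmostHermitianNP.NullTetrad.kappa_eq_zero hH hx,
          AlmostHermitianNP.NullTetrad.sigma_eq_zero hH hx]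
        ring
      · simp
    rw [AlmostHermitianNP.NullTetrad.dolDolT_eq w p hs hx,
      AlmostHermitianNP.NullTetrad.dolCommutator_eq w p hs hx,
      AlmostHermitianNP.NullTetrad.Psi2_eq_zero hS hx]
    constructor
    · linear_combination -ψ x * hp
    · linear_combination 2 * ψ x * hp
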